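/- For a finite graph $G$, the bipartition number $\tau(G)$ is the minimum number of complete bipartite subgraphs of $G$ that are pairwise edge-disjoint and whose union is the edge set of $G$. Let $G(n,1/2)$ be the random graph on $n$ labelled vertices in which each pair of vertices is an edge independently with probability $1/2$. Theorem. There is a deterministic function $\delta:\mathbb{N}\to\mathbb{R}$ with $\delta(n)\to 0$ as $n\to\infty$ such that, for any positive constants $c$ and $\epsilon$, a random graph $G\in G(n,1/2)$ satisfies $$n-c(\log_2 n)^{3+\epsilon}\;\le\;\tau(G)\;\le\; n-(2+\delta(n))\log_2 n$$ asymptotically almost surely, i.e. with probability tending to $1$ as $n\to\infty$. -/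

import Mathlib

open Filter Topology MeasureTheory

/-- `H` is (the edge set of) a complete bipartite graph `K_{A,B}` with disjoint parts `A, B ⊆ V`.
Empty parts are harmless: they give the graph without edges, which never helps a minimum. -/
def IsBiclique {V : Type*} (H : SimpleGraph V) : Prop :=
  ∃ A B : Set V, Disjoint A B ∧ ∀ u v, H.Adj u v ↔ (u ∈ A ∧ v ∈ B) ∨ (u ∈ B ∧ v ∈ A)

/-- The family `H` of complete bipartite graphs is edge-disjoint, and its union is the edge set
of `G`. -/
structure IsBicliquePartition {V : Type*} (G : SimpleGraph V) {k : ℕ}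
    (H : Fin k → SimpleGraph V) : Prop where
  biclique : ∀ i, IsBiclique (H i)
  disjoint : ∀ i j, i ≠ j → Disjoint (H i).edgeSet (H j).edgeSet
  union : ⋃ i, (H i).edgeSet = G.edgeSet

/-- The bipartition number `τ(G)`: the least number of complete bipartite subgraphs that are
edge-disjoint and whose union is the edge set of `G`. -/
noncomputable def bipartitionNumber {V : Type*} (G : SimpleGraph V) : ℕ :=
  sInf {k : ℕ | ∃ H : Fin k → SimpleGraph V, IsBicliquePartition G H}

/-- On a finite vertex set the minimum is over a nonempty set (partition into single edges), hence
it is attained. -/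
theorem bipartitionNumber_spec {V : Type*} [Finite V] (G : SimpleGraph V) :
    ∃ H : Fin (bipartitionNumber G) → SimpleGraph V, IsBicliquePartition G H := by
  have hne : {k : ℕ | ∃ H : Fin k → SimpleGraph V, IsBicliquePartition G H}.Nonempty := by
    obtain ⟨k, ⟨e⟩⟩ := Finite.exists_equiv_fin G.edgeSet
    have key : ∀ i, (SimpleGraph.fromEdgeSet {((e.symm i : G.edgeSet) : Sym2 V)}).edgeSet
        = {((e.symm i : G.edgeSet) : Sym2 V)} := by
      intro i
      rw [SimpleGraph.edgeSet_fromEdgeSet]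
      ext x
      constructor
      · exact fun h => h.1
      · intro h
        refine ⟨h, ?_⟩
        rw [Set.mem_singleton_iff] at h
        subst h
        exact G.not_isDiag_of_mem_edgeSet (e.symm i).2
    refine ⟨k, fun i => SimpleGraph.fromEdgeSet {((e.symm i : G.edgeSet) : Sym2 V)}, ?_, ?_, ?_⟩
    · intro i
      obtain ⟨x, hx⟩ := e.symm i
      induction x using Sym2.ind with
      | _ a b =>
        have hab : a ≠ b := G.ne_of_adj hx
        refine ⟨{a}, {b}, by simpa using hab, ?_⟩
        intro u v
        simp only [SimpleGraph.fromEdgeSet_adj, Set.mem_singleton_iff, Sym2.eq_iff]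
        grind
    · intro i j hij
      rw [key, key, Set.disjoint_singleton]
      exact fun h => hij (e.symm.injective (Subtype.ext h))
    · ext x
      simp only [key, Set.mem_iUnion, Set.mem_singleton_iff]
      constructor
      · rintro ⟨i, rfl⟩
        exact (e.symm i).2
      · intro h
        exact ⟨e ⟨x, h⟩, by simp⟩
  exact Nat.sInf_mem hne

/-- The law `G(n, 1/2)`: the binomial random graph on `n` labelled vertices, in which every edge is
present independently with probability `1/2`. -/
noncomputable def randomGraphHalf (n : ℕ) : Measure (SimpleGraph (Fin n)) :=
  SimpleGraph.binomialRandom (Fin n) ⟨1 / 2, by norm_num, by norm_num⟩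

section Cube

open scoped Classical in
/-- The proportion of the subsets of `E` that satisfy `p`. -/
noncomputable def density {E : Type*} [Fintype E] (p : Finset E → Prop) : ℝ :=
  (Finset.univ.filter p).card / 2 ^ Fintype.card E

/-- The cubeMean of `f` over all subsets of `E`. -/
noncomputable def cubeMean {E : Type*} [Fintype E] (f : Finset E → ℝ) : ℝ :=
  (∑ x, f x) / 2 ^ Fintype.card E

variable {E : Type*} [Fintype E]

lemma density_nonneg (p : Finset E → Prop) : 0 ≤ density p := by
  unfold density; positivity

lemma density_eq_card (p : Finset E → Prop) [DecidablePred p] :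
    density p = (Finset.univ.filter p).card / 2 ^ Fintype.card E := by
  unfold density
  congr!

lemma density_eq_cubeMean (p : Finset E → Prop) [DecidablePred p] :
    density p = cubeMean fun x => if p x then (1 : ℝ) else 0 := by
  classical
  rw [density_eq_card, cubeMean, Finset.sum_boole]

lemma density_mono {p p' : Finset E → Prop} (h : ∀ x, p x → p' x) : density p ≤ density p' := by
  classical
  unfold density
  gcongr with x
  exact h x

lemma density_true : density (fun _ : Finset E => True) = 1 := by
  simp [density]

lemma density_le_one (p : Finset E → Prop) : density p ≤ 1 :=
  (density_mono fun _ _ => trivial).trans_eq density_true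

lemma density_congr {p p' : Finset E → Prop} (h : ∀ x, p x ↔ p' x) : density p = density p' := by
  rw [show p = p' from funext fun x => propext (h x)]

lemma density_not (p : Finset E → Prop) : density (fun x => ¬ p x) = 1 - density p := by
  classical
  have h := Finset.card_filter_add_card_filter_not (s := (Finset.univ : Finset (Finset E))) p
  rw [Finset.card_univ, Fintype.card_finset] at h
  have h' : ((Finset.univ.filter p).card : ℝ) + (Finset.univ.filter fun x => ¬ p x).card
      = 2 ^ Fintype.card E := by exact_mod_cast h
  rw [density_eq_card, density_eq_card p, eq_sub_iff_add_eq, ← add_div, add_comm, h',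
    div_self (by positivity)]

lemma density_or_le (p p' : Finset E → Prop) :
    density (fun x => p x ∨ p' x) ≤ density p + density p' := by
  classical
  rw [density_eq_card, density_eq_card p, density_eq_card p', ← add_div]
  gcongr
  rw [Finset.filter_or]
  exact_mod_cast Finset.card_union_le _ _

lemma density_exists_le {α : Type*} (s : Finset α) (p : α → Finset E → Prop) :
    density (fun x => ∃ a ∈ s, p a x) ≤ ∑ a ∈ s, density (p a) := by
  classical
  induction s using Finset.induction_on with
  | empty => simp [density]
  | insert a s ha ih =>
    rw [Finset.sum_insert ha]
    refine le_trans ?_ (add_le_add_right ih _)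
    simpa using density_or_le (p a) (fun x => ∃ a ∈ s, p a x)

lemma density_exists_le_card_mul {α : Type*} (s : Finset α) (p : α → Finset E → Prop) {b : ℝ}
    (h : ∀ a ∈ s, density (p a) ≤ b) : density (fun x => ∃ a ∈ s, p a x) ≤ s.card * b := by
  refine (density_exists_le s p).trans ?_
  simpa using Finset.sum_le_card_nsmul s _ _ h

variable [DecidableEq E]

lemma density_superset (T : Finset E) : density (fun x => T ⊆ x) = (2 ^ T.card)⁻¹ := by
  classical
  have h : (Finset.univ.filter fun x => T ⊆ x) = Finset.Icc T Finset.univ := by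
    ext x; simp
  rw [density_eq_card, show (Finset.univ.filter fun x => T ⊆ x).card = 2 ^ (Fintype.card E - T.card) by
    rw [h, Finset.card_Icc_finset (Finset.subset_univ _), Finset.card_univ]]
  have : (2 : ℝ) ^ Fintype.card E = 2 ^ (Fintype.card E - T.card) * 2 ^ T.card := by
    rw [← pow_add, Nat.sub_add_cancel (Finset.card_le_univ T)]
  rw [this]
  push_cast
  field_simp

lemma density_disjoint (T : Finset E) : density (fun x => Disjoint T x) = (2 ^ T.card)⁻¹ := by
  classical
  rw [← density_superset T, density_eq_card, density_eq_card]
  congr 2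
  refine Finset.card_bij' (fun x _ => xᶜ) (fun x _ => xᶜ) ?_ ?_ ?_ ?_
  · intro x hx
    simpa [Finset.subset_compl_iff_disjoint_right] using hx
  · intro x hx
    simpa [disjoint_compl_right_iff] using hx
  · simp
  · simp

lemma sum_symmDiff_singleton (a : E) (f : Finset E → ℝ) :
    ∑ x, f (symmDiff x {a}) = ∑ x, f x :=
  Function.Bijective.sum_comp
    (Function.Involutive.bijective fun x => symmDiff_symmDiff_cancel_right {a} x) f

lemma density_mem_and (a : E) (p : Finset E → Prop) (h : ∀ x, p (symmDiff x {a}) ↔ p x) :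
    density (fun x => a ∈ x ∧ p x) = density p / 2 := by
  classical
  rw [density_eq_cubeMean, density_eq_cubeMean p]
  unfold cubeMean
  have h1 : ∑ x : Finset E, (if a ∈ x ∧ p x then (1 : ℝ) else 0)
      = ∑ x : Finset E, (if a ∉ x ∧ p x then (1 : ℝ) else 0) := by
    rw [← sum_symmDiff_singleton a]
    refine Finset.sum_congr rfl fun x _ => ?_
    rw [h]
    simp [Finset.mem_symmDiff]
  have h2 : ∑ x : Finset E, (if p x then (1 : ℝ) else 0)
      = ∑ x : Finset E, (if a ∈ x ∧ p x then (1 : ℝ) else 0)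
        + ∑ x : Finset E, (if a ∉ x ∧ p x then (1 : ℝ) else 0) := by
    rw [← Finset.sum_add_distrib]
    refine Finset.sum_congr rfl fun x _ => ?_
    by_cases hx : a ∈ x <;> simp [hx]
  rw [h2, ← h1]
  ring

/-- Exponential moments of a function on the cube with bounded differences. -/
lemma sum_exp_le_of_bounded_differences (S : Finset E) (c : E → ℝ) (f : Finset E → ℝ)
    (hc : ∀ e x, |f x - f (symmDiff x {e})| ≤ c e)
    (hS : ∀ e ∉ S, ∀ x, f (symmDiff x {e}) = f x) :
    ∑ x, Real.exp (f x) ≤ 2 ^ Fintype.card E * Real.exp (cubeMean f + (∑ e ∈ S, c e ^ 2) / 8) := by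
  induction S using Finset.induction_on generalizing f with
  | empty =>
    have hconst : ∀ x, f x = f ∅ := by
      intro x
      induction x using Finset.induction_on with
      | empty => rfl
      | insert a s ha ih =>
        rw [← ih, ← hS a (by simp) s]
        congr 1
        ext b
        simp only [Finset.mem_insert, Finset.mem_symmDiff, Finset.mem_singleton]
        grind
    have hav : cubeMean f = f ∅ := by
      unfold cubeMean
      simp only [hconst, Finset.sum_const, Finset.card_univ, Fintype.card_finset, nsmul_eq_mul]
      push_cast
      field_simp
    simp only [hconst, Finset.sum_const, Finset.card_univ, Fintype.card_finset, nsmul_eq_mul, hav]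
    simp
  | insert a S ha ih =>
    set f' : Finset E → ℝ := fun x => (f x + f (symmDiff x {a})) / 2 with hf'
    have hcomm : ∀ (e : E) (x : Finset E), symmDiff (symmDiff x {e}) {a} = symmDiff (symmDiff x {a}) {e} :=
      fun e x => symmDiff_right_comm x {e} {a}
    have hav : cubeMean f' = cubeMean f := by
      unfold cubeMean
      congr 1
      rw [hf', ← Finset.sum_div, Finset.sum_add_distrib, sum_symmDiff_singleton]
      ring
    have key := ih f' (fun e x => by
        have h1 := hc e x
        have h2 := hc e (symmDiff x {a})
        simp only [hf', hcomm]
        rw [abs_le] at *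
        constructor <;> linarith [h1.1, h1.2, h2.1, h2.2]) (fun e he x => by
        by_cases hea : e = a
        · subst hea
          simp only [hf', symmDiff_symmDiff_cancel_right]
          ring
        · have := hS e (by simp [hea, he])
          simp only [hf', hcomm, this])
    have hpt : ∀ x, (Real.exp (f x) + Real.exp (f (symmDiff x {a}))) / 2
        ≤ Real.exp (f' x) * Real.exp (c a ^ 2 / 8) := by
      intro x
      set d := (f x - f (symmDiff x {a})) / 2 with hd
      have e1 : f x = f' x + d := by simp only [hf', hd]; ring
      have e2 : f (symmDiff x {a}) = f' x + -d := by simp only [hf', hd]; ring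
      have h1 : (Real.exp (f x) + Real.exp (f (symmDiff x {a}))) / 2
          = Real.exp (f' x) * Real.cosh d := by
        rw [e1, e2, Real.exp_add, Real.exp_add, Real.cosh_eq]
        ring
      rw [h1]
      gcongr
      refine (Real.cosh_le_exp_half_sq d).trans (Real.exp_le_exp.2 ?_)
      have h2 : (f x - f (symmDiff x {a})) ^ 2 ≤ c a ^ 2 :=
        sq_le_sq' (by linarith [(abs_le.1 (hc a x)).1]) ((abs_le.1 (hc a x)).2)
      have : d ^ 2 = (f x - f (symmDiff x {a})) ^ 2 / 4 := by rw [hd]; ring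
      rw [this]
      linarith
    calc ∑ x, Real.exp (f x)
        = ∑ x, (Real.exp (f x) + Real.exp (f (symmDiff x {a}))) / 2 := by
          rw [← Finset.sum_div, Finset.sum_add_distrib,
            sum_symmDiff_singleton a fun x => Real.exp (f x)]
          ring
      _ ≤ ∑ x, Real.exp (f' x) * Real.exp (c a ^ 2 / 8) := Finset.sum_le_sum fun x _ => hpt x
      _ = (∑ x, Real.exp (f' x)) * Real.exp (c a ^ 2 / 8) := by rw [Finset.sum_mul]
      _ ≤ 2 ^ Fintype.card E * Real.exp (cubeMean f' + (∑ e ∈ S, c e ^ 2) / 8)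
            * Real.exp (c a ^ 2 / 8) := by gcongr
      _ = _ := by
          rw [mul_assoc, ← Real.exp_add, Finset.sum_insert ha, hav]
          congr 2
          ring

/-- The lower tail in McDiarmid's inequality on the cube. -/
theorem density_le_cubeMean_sub_le (c : E → ℝ) (f : Finset E → ℝ)
    (hc : ∀ e x, |f x - f (symmDiff x {e})| ≤ c e) {v s : ℝ} (hv : 0 < v) (hs : 0 ≤ s)
    (hcv : ∑ e, c e ^ 2 ≤ v) :
    density (fun x => f x ≤ cubeMean f - s) ≤ Real.exp (-(2 * s ^ 2 / v)) := by
  classical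
  set b := 4 * s / v with hb
  have hb0 : 0 ≤ b := by positivity
  have key := sum_exp_le_of_bounded_differences Finset.univ (fun e => b * c e) (fun x => -b * f x)
    (fun e x => by
      rw [← mul_sub, abs_mul, abs_neg, abs_of_nonneg hb0]
      exact mul_le_mul_of_nonneg_left (hc e x) hb0) (by simp)
  have hav : cubeMean (fun x => -b * f x) = -b * cubeMean f := by
    unfold cubeMean
    rw [← Finset.mul_sum]
    ring
  have hlow : ((Finset.univ.filter fun x => f x ≤ cubeMean f - s).card : ℝ)
      * Real.exp (-b * (cubeMean f - s)) ≤ ∑ x, Real.exp (-b * f x) := by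
    rw [← nsmul_eq_mul]
    refine (Finset.card_nsmul_le_sum _ (fun x => Real.exp (-b * f x)) _ fun x hx => ?_).trans
      (Finset.sum_le_univ_sum_of_nonneg fun x => (Real.exp_pos _).le)
    rw [Finset.mem_filter] at hx
    exact Real.exp_le_exp.2 (by nlinarith [hx.2])
  have hsum : ∑ e, (b * c e) ^ 2 ≤ b ^ 2 * v := by
    simp_rw [mul_pow]
    rw [← Finset.mul_sum]
    gcongr
  rw [density_eq_card, div_le_iff₀ (by positivity)]
  have h3 : ((Finset.univ.filter fun x => f x ≤ cubeMean f - s).card : ℝ)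
      ≤ 2 ^ Fintype.card E * Real.exp (cubeMean (fun x => -b * f x) + (∑ e, (b * c e) ^ 2) / 8)
        * Real.exp (b * (cubeMean f - s)) := by
    have h4 := hlow.trans key
    calc _ = ((Finset.univ.filter fun x => f x ≤ cubeMean f - s).card : ℝ)
          * Real.exp (-b * (cubeMean f - s)) * Real.exp (b * (cubeMean f - s)) := by
          rw [mul_assoc, ← Real.exp_add]; simp
      _ ≤ _ := by gcongr
  refine h3.trans ?_
  rw [mul_assoc, ← Real.exp_add, mul_comm]
  gcongr
  rw [hav]
  have : b * s = 4 * s ^ 2 / v := by rw [hb]; ring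
  have h5 : b ^ 2 * v = 16 * s ^ 2 / v := by rw [hb]; field_simp; ring
  have h6 : 4 * s ^ 2 / v = 2 * (2 * s ^ 2 / v) := by ring
  have h7 : 16 * s ^ 2 / v = 8 * (2 * s ^ 2 / v) := by ring
  nlinarith

/-- The Harris inequality for finitely many decreasing properties. -/
lemma prod_density_le {ι : Type*} (s : Finset ι) (p : ι → Finset E → Prop)
    (hp : ∀ i x y, y ⊆ x → p i x → p i y) :
    ∏ i ∈ s, density (p i) ≤ density fun x => ∀ i ∈ s, p i x := by
  classical
  induction s using Finset.induction_on with
  | empty => simp [density_true]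
  | insert a s ha ih =>
    rw [Finset.prod_insert ha]
    refine (mul_le_mul_of_nonneg_left ih (density_nonneg _)).trans ?_
    have h := IsLowerSet.le_card_inter_finset (𝒜 := Finset.univ.filter (p a))
      (ℬ := Finset.univ.filter fun x => ∀ i ∈ s, p i x)
      (fun x y hxy hx => by simpa using hp a x y hxy (by simpa using hx))
      (fun x y hxy hx => by
        have hx' : ∀ i ∈ s, p i x := by simpa using hx
        simpa using fun i hi => hp i x y hxy (hx' i hi))
    rw [← Finset.filter_and] at h
    have h' : ((Finset.univ.filter (p a)).card : ℝ)
        * (Finset.univ.filter fun x => ∀ i ∈ s, p i x).card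
        ≤ 2 ^ Fintype.card E
          * (Finset.univ.filter fun x => p a x ∧ ∀ i ∈ s, p i x).card := by exact_mod_cast h
    have h2 : density (fun x => ∀ i ∈ insert a s, p i x)
        = density fun x => p a x ∧ ∀ i ∈ s, p i x := density_congr (by simp)
    rw [h2, density_eq_card, density_eq_card, density_eq_card, div_mul_div_comm,
      div_le_div_iff₀ (by positivity) (by positivity)]
    calc _ ≤ 2 ^ Fintype.card E
          * ((Finset.univ.filter fun x => p a x ∧ ∀ i ∈ s, p i x).card : ℝ)
          * 2 ^ Fintype.card E := mul_le_mul_of_nonneg_right h' (by positivity)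
      _ = _ := by ring

lemma four_rpow_neg_le_one_sub {x : ℝ} (h0 : 0 ≤ x) (h1 : x ≤ 1 / 2) :
    (4 : ℝ) ^ (-x) ≤ 1 - x := by
  have hconv : ConvexOn ℝ Set.univ fun y : ℝ => (4 : ℝ) ^ y :=
    convexOn_rpow_left (by norm_num)
  have h := hconv.2 (Set.mem_univ (0 : ℝ)) (Set.mem_univ (-1 / 2 : ℝ))
    (show 0 ≤ 1 - 2 * x by linarith) (show 0 ≤ 2 * x by linarith) (by ring)
  have h4 : (4 : ℝ) ^ (-1 / 2 : ℝ) = 1 / 2 := by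
    rw [show (4 : ℝ) = 2 ^ (2 : ℝ) by norm_num, ← Real.rpow_mul (by norm_num)]
    norm_num [Real.rpow_neg_one]
  simp only [smul_eq_mul, h4, Real.rpow_zero] at h
  calc (4 : ℝ) ^ (-x) = 4 ^ ((1 - 2 * x) * 0 + 2 * x * (-1 / 2)) := by congr 1; ring
    _ ≤ _ := h
    _ = 1 - x := by ring

/-- A point lies in a random set which contains no member of a given family of sets avoiding the
point, with probability bounded below. -/
lemma le_density_mem_and_forall_not_subset {ι : Type*} (s : Finset ι) (T : ι → Finset E) (a : E)
    (hT : ∀ i ∈ s, (T i).Nonempty) (ha : ∀ i ∈ s, a ∉ T i) :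
    (4 : ℝ) ^ (-∑ i ∈ s, ((2 : ℝ) ^ (T i).card)⁻¹) / 2
      ≤ density fun x => a ∈ x ∧ ∀ i ∈ s, ¬ T i ⊆ x := by
  rw [density_mem_and a]
  · gcongr
    refine le_trans ?_ (prod_density_le s (fun i x => ¬ T i ⊆ x) fun i x y hyx h h' =>
      h (h'.trans hyx))
    rw [← Finset.sum_neg_distrib, Real.rpow_sum_of_pos (by norm_num)]
    refine Finset.prod_le_prod (fun i _ => by positivity) fun i hi => ?_
    rw [density_not, density_superset]
    refine four_rpow_neg_le_one_sub (by positivity) ?_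
    have h1 := (hT i hi).card_pos
    rw [one_div]
    gcongr
    exact le_self_pow₀ (by norm_num) h1.ne'
  · intro x
    refine forall₂_congr fun i hi => not_congr ?_
    have : ∀ b ∈ T i, (b ∈ symmDiff x {a} ↔ b ∈ x) := fun b hb => by
      have hba : b ≠ a := fun h => ha i hi (h ▸ hb)
      simp [Finset.mem_symmDiff, hba]
    exact forall₂_congr this

end Cube

section RandomGraph

variable {V : Type*} [Fintype V] [DecidableEq V]

lemma card_filter_fromEdgeSet_eq (G : SimpleGraph V) [DecidableRel G.Adj]
    [DecidablePred fun x : Finset (Sym2 V) => SimpleGraph.fromEdgeSet (x : Set (Sym2 V)) = G] :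
    (Finset.univ.filter fun x : Finset (Sym2 V) =>
      SimpleGraph.fromEdgeSet (x : Set (Sym2 V)) = G).card = 2 ^ Fintype.card V := by
  have hdiag : (Finset.univ.filter fun e : Sym2 V => e.IsDiag).card = Fintype.card V := by
    rw [← Finset.card_univ, ← Finset.card_image_of_injective Finset.univ Sym2.diag_injective]
    congr 1
    ext e
    simp only [Finset.mem_filter, Finset.mem_univ, true_and, Finset.mem_image]
    exact ⟨fun h => by
      induction e with
      | _ a b => exact ⟨a, by simpa [Sym2.diag] using h⟩, by rintro ⟨a, rfl⟩; simp⟩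
  have himg : (Finset.univ.filter fun x : Finset (Sym2 V) =>
      SimpleGraph.fromEdgeSet (x : Set (Sym2 V)) = G)
      = (Finset.univ.filter fun e : Sym2 V => e.IsDiag).powerset.image (· ∪ G.edgeFinset) := by
    ext x
    simp only [Finset.mem_filter, Finset.mem_univ, true_and, Finset.mem_image,
      Finset.mem_powerset]
    constructor
    · intro h
      refine ⟨x.filter fun e => e.IsDiag, fun e he => by
        simp only [Finset.mem_filter, Finset.mem_univ, true_and] at he ⊢; exact he.2, ?_⟩
      ext e
      have he : e ∈ G.edgeSet ↔ e ∈ x ∧ ¬ e.IsDiag := by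
        rw [← h, SimpleGraph.edgeSet_fromEdgeSet]; simp
      simp only [Finset.mem_union, Finset.mem_filter, SimpleGraph.mem_edgeFinset, he]
      tauto
    · rintro ⟨D, hD, rfl⟩
      ext a b
      rw [SimpleGraph.fromEdgeSet_adj]
      simp only [Finset.coe_union, SimpleGraph.coe_edgeFinset, Set.mem_union, Finset.mem_coe,
        SimpleGraph.mem_edgeSet]
      constructor
      · rintro ⟨h | h, hab⟩
        · exact absurd (by simpa using hD h) hab
        · exact h
      · exact fun h => ⟨Or.inr h, h.ne⟩
  rw [himg, Finset.card_image_of_injOn, Finset.card_powerset, hdiag]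
  intro D hD D' hD' h
  rw [Finset.mem_coe, Finset.mem_powerset] at hD hD'
  ext e
  have h1 : e ∈ D ∪ G.edgeFinset ↔ e ∈ D' ∪ G.edgeFinset := by
    simp only at h; rw [h]
  simp only [Finset.mem_union, SimpleGraph.mem_edgeFinset] at h1
  by_cases he : e.IsDiag
  · have : e ∉ G.edgeSet := fun h => G.not_isDiag_of_mem_edgeSet h he
    tauto
  · exact ⟨fun h => absurd (by simpa using hD h) he, fun h => absurd (by simpa using hD' h) he⟩

instance {V : Type*} [Countable V] : MeasurableSingletonClass (SimpleGraph V) where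
  measurableSet_singleton G := by
    rw [← SimpleGraph.measurableEmbedding_edgeSet.measurableSet_image, Set.image_singleton]
    exact measurableSet_singleton _

instance (n : ℕ) : IsProbabilityMeasure (randomGraphHalf n) :=
  inferInstanceAs (IsProbabilityMeasure (SimpleGraph.binomialRandom (Fin n) _))

lemma randomGraphHalf_real_singleton (n : ℕ) (G : SimpleGraph (Fin n)) :
    (randomGraphHalf n).real {G} = (2 ^ n.choose 2)⁻¹ := by
  classical
  have hle : G.edgeSet.ncard ≤ n.choose 2 := by
    have := SimpleGraph.card_edgeFinset_le_card_choose_two (G := G)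
    rwa [Fintype.card_fin, ← Set.ncard_coe_finset, SimpleGraph.coe_edgeFinset] at this
  have hσ : unitInterval.toNNReal (unitInterval.symm ⟨1 / 2, by norm_num, by norm_num⟩)
      = unitInterval.toNNReal ⟨1 / 2, by norm_num, by norm_num⟩ := by
    congr 1
    ext
    norm_num
  rw [measureReal_def, randomGraphHalf, SimpleGraph.binomialRandom_singleton, hσ, ← pow_add,
    Nat.card_fin, Nat.add_sub_cancel' hle]
  simp [ENNReal.toReal_pow]

/-- Probabilities in `G(n, 1/2)` are proportions of the sets of unordered pairs. -/
theorem randomGraphHalf_real (n : ℕ) (P : SimpleGraph (Fin n) → Prop) :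
    (randomGraphHalf n).real {G | P G}
      = density fun x : Finset (Sym2 (Fin n)) => P (SimpleGraph.fromEdgeSet (x : Set _)) := by
  classical
  have h1 : (randomGraphHalf n).real {G | P G}
      = (Finset.univ.filter P).card * (2 ^ n.choose 2 : ℝ)⁻¹ := by
    rw [show {G | P G} = ((Finset.univ.filter P : Finset (SimpleGraph (Fin n))) : Set _) by
      ext; simp, ← sum_measureReal_singleton]
    simp [randomGraphHalf_real_singleton]
  have h2 : (Finset.univ.filter fun x : Finset (Sym2 (Fin n)) =>
      P (SimpleGraph.fromEdgeSet (x : Set _))).card = (Finset.univ.filter P).card * 2 ^ n := by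
    rw [Finset.card_eq_sum_card_fiberwise
      (f := fun x : Finset (Sym2 (Fin n)) => SimpleGraph.fromEdgeSet (x : Set _))
      (t := Finset.univ.filter P) (fun x hx => by simpa using hx), ← smul_eq_mul,
      ← Finset.sum_const]
    refine Finset.sum_congr rfl fun G hG => ?_
    have := card_filter_fromEdgeSet_eq G
    rw [Fintype.card_fin] at this
    rw [← this, Finset.filter_filter]
    congr 1
    ext x
    simp only [Finset.mem_filter, Finset.mem_univ, true_and, and_iff_right_iff_imp] at hG ⊢
    rintro rfl
    exact hG
  have h3 : Fintype.card (Sym2 (Fin n)) = n.choose 2 + n := by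
    rw [Sym2.card, Fintype.card_fin, Nat.choose_succ_succ' n 1]
    simp [add_comm]
  rw [h1, density_eq_card, h2, h3, pow_add]
  push_cast
  field_simp

end RandomGraph

section StarPartition

/-- Stars at the vertices outside an independent set partition the edges of a graph. -/
theorem bipartitionNumber_le_of_isIndepSet {n : ℕ} (G : SimpleGraph (Fin n)) (S : Finset (Fin n))
    (hS : ∀ u ∈ S, ∀ v ∈ S, ¬ G.Adj u v) : bipartitionNumber G ≤ n - S.card := by
  classical
  have hcard : Fintype.card {v // v ∉ S} = n - S.card := by
    rw [Fintype.card_subtype_compl, Fintype.card_fin, Fintype.card_coe]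
  set φ := Fintype.equivFinOfCardEq hcard with hφ
  have hstar : ∀ v : {v // v ∉ S}, ∃ H : SimpleGraph (Fin n), ∀ a b, H.Adj a b ↔
      (a ∈ ({v.1} : Set (Fin n)) ∧ b ∈ {w | G.Adj v w ∧ (w ∉ S → v.1 < w)}) ∨
      (a ∈ {w | G.Adj v w ∧ (w ∉ S → v.1 < w)} ∧ b ∈ ({v.1} : Set (Fin n))) := by
    intro v
    refine ⟨⟨fun a b => _, ⟨fun a b h => ?_⟩, ⟨fun a h => ?_⟩⟩, fun a b => Iff.rfl⟩
    · exact h.symm.imp And.symm And.symm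
    · rcases h with ⟨rfl, h⟩ | ⟨h, rfl⟩ <;> exact G.irrefl h.1
  choose H hH using hstar
  refine Nat.sInf_le ⟨fun i => H (φ.symm i), fun i => ⟨_, _, ?_, hH _⟩, ?_, ?_⟩
  · rw [Set.disjoint_singleton_left]
    exact fun h => G.irrefl h.1
  · intro i j hij
    rw [Set.disjoint_left]
    intro e
    induction e with
    | _ a b =>
      intro h1 h2
      refine hij (φ.symm.injective (Subtype.ext ?_))
      rw [SimpleGraph.mem_edgeSet, hH] at h1 h2
      have k1 := (φ.symm i).2
      have k2 := (φ.symm j).2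
      simp only [Set.mem_singleton_iff, Set.mem_ofPred_eq] at h1 h2
      grind
  · ext e
    induction e with
    | _ a b =>
      simp only [Set.mem_iUnion, SimpleGraph.mem_edgeSet, hH, Set.mem_singleton_iff,
        Set.mem_ofPred_eq]
      constructor
      · rintro ⟨i, ⟨h1, h2⟩ | ⟨h1, h2⟩⟩
        · exact h1 ▸ h2.1
        · exact h2 ▸ h1.1.symm
      · intro hab
        by_cases ha : a ∈ S
        · have hb : b ∉ S := fun hb => hS a ha b hb hab
          exact ⟨φ ⟨b, hb⟩, Or.inr (by simp [hab.symm, ha])⟩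
        · by_cases hb : b ∈ S
          · exact ⟨φ ⟨a, ha⟩, Or.inl (by simp [hab, hb])⟩
          · rcases lt_or_gt_of_ne hab.ne with h | h
            · exact ⟨φ ⟨a, ha⟩, Or.inl (by simp [hab, h])⟩
            · exact ⟨φ ⟨b, hb⟩, Or.inr (by simp [hab.symm, h])⟩

end StarPartition

section SecondMoment

lemma Nat.choose_sub_mul_pow_le {n k u : ℕ} (huk : u ≤ k) (hkn : k ≤ n) :
    (n - u).choose (k - u) * n ^ u ≤ k ^ u * n.choose k := by
  induction u with
  | zero => simp
  | succ u ih =>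
    have ih := ih (by omega)
    obtain ⟨a, rfl⟩ : ∃ a, k = a + (u + 1) := ⟨k - (u + 1), by omega⟩
    obtain ⟨b, rfl⟩ : ∃ b, n = a + b + (u + 1) := ⟨n - (a + (u + 1)), by omega⟩
    have e1 : a + b + (u + 1) - u = a + b + 1 := by omega
    have e2 : a + (u + 1) - u = a + 1 := by omega
    rw [e1, e2] at ih
    rw [Nat.add_sub_cancel, Nat.add_sub_cancel]
    have h := Nat.add_one_mul_choose_eq (a + b) a
    have h2 : (a + b).choose a * (a + b + (u + 1))
        ≤ (a + (u + 1)) * (a + b + 1).choose (a + 1) := by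
      refine Nat.le_of_mul_le_mul_left (c := a + b + 1) ?_ (by omega)
      calc (a + b + 1) * ((a + b).choose a * (a + b + (u + 1)))
          = (a + b + 1).choose (a + 1) * ((a + 1) * (a + b + (u + 1))) := by
            rw [← mul_assoc, h]; ring
        _ ≤ (a + b + 1).choose (a + 1) * ((a + b + 1) * (a + (u + 1))) := by
            refine Nat.mul_le_mul_left _ ?_
            nlinarith
        _ = _ := by ring
    calc (a + b).choose a * (a + b + (u + 1)) ^ (u + 1)
        = ((a + b).choose a * (a + b + (u + 1))) * (a + b + (u + 1)) ^ u := by ring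
      _ ≤ ((a + (u + 1)) * (a + b + 1).choose (a + 1)) * (a + b + (u + 1)) ^ u := by gcongr
      _ = (a + (u + 1)) * ((a + b + 1).choose (a + 1) * (a + b + (u + 1)) ^ u) := by ring
      _ ≤ (a + (u + 1)) * ((a + (u + 1)) ^ u * (a + b + (u + 1)).choose (a + (u + 1))) := by
          gcongr
      _ = _ := by ring

variable {V : Type*} [DecidableEq V]

/-- The unordered pairs of distinct elements of `S`. -/
def pairsIn (S : Finset V) : Finset (Sym2 V) := S.sym2.filter fun e => ¬ e.IsDiag

lemma mk_mem_pairsIn {S : Finset V} {a b : V} : s(a, b) ∈ pairsIn S ↔ a ∈ S ∧ b ∈ S ∧ a ≠ b := by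
  simp [pairsIn, and_assoc]

lemma card_pairsIn (S : Finset V) : (pairsIn S).card = S.card.choose 2 := by
  have h := Finset.card_filter_add_card_filter_not (s := S.sym2) fun e => e.IsDiag
  have h1 : (S.sym2.filter fun e => e.IsDiag).card = S.card := by
    rw [← Finset.card_image_of_injective S Sym2.diag_injective]
    congr 1
    ext e
    induction e with
    | _ a b =>
      simp only [Finset.mem_filter, Finset.mk_mem_sym2_iff, Finset.mem_image, Sym2.diag,
        Sym2.mk_isDiag_iff, Sym2.eq_iff]
      grind
  rw [Finset.card_sym2, Nat.choose_succ_succ' S.card 1, h1, Nat.choose_one_right] at h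
  exact Nat.add_left_cancel h

variable [Fintype V]

lemma card_filter_superset_powersetCard_mul_pow_le {k : ℕ} (U : Finset V) (hU : U.card ≤ k)
    (hk : k ≤ Fintype.card V) :
    ((Finset.univ.powersetCard k).filter fun T => U ⊆ T).card * Fintype.card V ^ U.card
      ≤ k ^ U.card * (Fintype.card V).choose k := by
  refine le_trans (Nat.mul_le_mul_right _ ?_) (Nat.choose_sub_mul_pow_le hU hk)
  rw [← Finset.card_univ, ← Finset.card_sdiff_of_subset (Finset.subset_univ U),
    ← Finset.card_powersetCard]
  refine Finset.card_le_card_of_injOn (fun T => T \ U) ?_ ?_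
  · intro T hT
    simp only [Finset.coe_filter, Finset.mem_powersetCard, Set.mem_ofPred_eq] at hT
    rw [Finset.mem_coe, Finset.mem_powersetCard, Finset.card_sdiff_of_subset hT.2, hT.1.2]
    exact ⟨Finset.sdiff_subset_sdiff hT.1.1 le_rfl, rfl⟩
  · intro T hT T' hT' h
    simp only [Finset.coe_filter, Finset.mem_powersetCard, Set.mem_ofPred_eq] at hT hT'
    rw [← Finset.sdiff_union_of_subset hT.2, ← Finset.sdiff_union_of_subset hT'.2]
    simp only at h
    rw [h]

lemma two_pow_choose_two_le {j k : ℕ} (hjk : j ≤ k) :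
    (2 : ℝ) ^ j.choose 2 ≤ (1 + (2 : ℝ) ^ ((k : ℝ) / 2)) ^ j := by
  calc (2 : ℝ) ^ j.choose 2 = (2 : ℝ) ^ ((j.choose 2 : ℕ) : ℝ) := (Real.rpow_natCast _ _).symm
    _ ≤ (2 : ℝ) ^ ((k : ℝ) / 2 * j) := by
        refine Real.rpow_le_rpow_of_exponent_le (by norm_num) ?_
        rw [Nat.cast_choose_two]
        have : (j : ℝ) ≤ k := by exact_mod_cast hjk
        nlinarith [(Nat.cast_nonneg j : (0 : ℝ) ≤ j)]
    _ = ((2 : ℝ) ^ ((k : ℝ) / 2)) ^ j := by rw [Real.rpow_mul (by norm_num), Real.rpow_natCast]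
    _ ≤ _ := by gcongr; linarith

lemma sum_two_pow_choose_card_inter_le {k : ℕ} (hk : k ≤ Fintype.card V)
    (hV : 0 < Fintype.card V) (S : Finset V) (hS : S.card = k) :
    ∑ T ∈ Finset.univ.powersetCard k, (2 : ℝ) ^ (S ∩ T).card.choose 2
      ≤ (Fintype.card V).choose k
        * Real.exp ((k : ℝ) ^ 2 * (2 : ℝ) ^ ((k : ℝ) / 2) / Fintype.card V) := by
  set ρ : ℝ := (2 : ℝ) ^ ((k : ℝ) / 2) with hρ
  have hρ0 : 0 ≤ ρ := by positivity
  set n := Fintype.card V with hn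
  have hn0 : (0 : ℝ) < n := by exact_mod_cast hV
  calc ∑ T ∈ Finset.univ.powersetCard k, (2 : ℝ) ^ (S ∩ T).card.choose 2
      ≤ ∑ T ∈ Finset.univ.powersetCard k, ∑ U ∈ S.powerset, if U ⊆ T then ρ ^ U.card else 0 := by
        refine Finset.sum_le_sum fun T hT => ?_
        refine (two_pow_choose_two_le
          ((Finset.card_le_card Finset.inter_subset_left).trans_eq hS)).trans_eq ?_
        rw [add_comm, ← Finset.sum_pow_mul_eq_add_pow, ← Finset.sum_filter]
        refine Finset.sum_congr ?_ (by simp [hρ])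
        ext U
        simp only [Finset.mem_powerset, Finset.subset_inter_iff, Finset.mem_filter]
    _ = ∑ U ∈ S.powerset,
          (((Finset.univ.powersetCard k).filter fun T => U ⊆ T).card : ℝ) * ρ ^ U.card := by
        rw [Finset.sum_comm]
        refine Finset.sum_congr rfl fun U _ => ?_
        rw [← Finset.sum_filter, Finset.sum_const, nsmul_eq_mul]
    _ ≤ ∑ U ∈ S.powerset, (n.choose k : ℝ) * (ρ * (k / n)) ^ U.card := by
        refine Finset.sum_le_sum fun U hU => ?_
        have h := card_filter_superset_powersetCard_mul_pow_le U
          ((Finset.card_le_card (Finset.mem_powerset.1 hU)).trans_eq hS) hk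
        have h' : (((Finset.univ.powersetCard k).filter fun T => U ⊆ T).card : ℝ) * n ^ U.card
          ≤ k ^ U.card * n.choose k := by exact_mod_cast h
        rw [← le_div_iff₀ (by positivity)] at h'
        calc _ ≤ (k ^ U.card * n.choose k / n ^ U.card : ℝ) * ρ ^ U.card := by gcongr
          _ = _ := by rw [mul_pow, div_pow]; ring
    _ = n.choose k * (1 + ρ * (k / n)) ^ k := by
        rw [← Finset.mul_sum, add_comm, ← hS, ← Finset.sum_pow_mul_eq_add_pow]
        simp
    _ ≤ _ := by
        gcongr
        calc (1 + ρ * (k / n)) ^ k ≤ Real.exp (ρ * (k / n)) ^ k := by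
              gcongr
              rw [add_comm]
              exact Real.add_one_le_exp _
          _ = _ := by
              rw [← Real.exp_nat_mul]
              congr 1
              ring

lemma cubeMean_sum {E α : Type*} [Fintype E] (s : Finset α) (f : α → Finset E → ℝ) :
    cubeMean (fun x => ∑ a ∈ s, f a x) = ∑ a ∈ s, cubeMean (f a) := by
  unfold cubeMean
  rw [Finset.sum_comm, Finset.sum_div]

/-- Second moment bound for the absence of independent sets of size `k`. -/
theorem density_no_indep_le {k : ℕ} (hk : k ≤ Fintype.card V) (hV : 0 < Fintype.card V) :
    density (fun x : Finset (Sym2 V) => ∀ S : Finset V, S.card = k → ¬ Disjoint (pairsIn S) x)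
      ≤ Real.exp ((k : ℝ) ^ 2 * (2 : ℝ) ^ ((k : ℝ) / 2) / Fintype.card V) - 1 := by
  classical
  set B := Real.exp ((k : ℝ) ^ 2 * (2 : ℝ) ^ ((k : ℝ) / 2) / Fintype.card V) with hB
  set P := (Finset.univ : Finset V).powersetCard k with hP
  set X : Finset (Sym2 V) → ℝ := fun x => ∑ S ∈ P, if Disjoint (pairsIn S) x then 1 else 0 with hX
  set p : ℝ := (2 ^ k.choose 2)⁻¹ with hp
  have hp0 : 0 < p := by positivity
  have hPc : P.card = (Fintype.card V).choose k := by
    rw [hP, Finset.card_powersetCard, Finset.card_univ]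
  set N : ℝ := ((P.card : ℕ) : ℝ) with hN
  have hN0 : 0 < N := by
    rw [hN, hPc]; exact_mod_cast Nat.choose_pos hk
  have h1 : cubeMean X = N * p := by
    rw [hX, cubeMean_sum, hN, ← nsmul_eq_mul, ← Finset.sum_const]
    refine Finset.sum_congr rfl fun S hS => ?_
    rw [← density_eq_cubeMean, density_disjoint, card_pairsIn, (Finset.mem_powersetCard.1 hS).2]
  have h2 : cubeMean (fun x => X x ^ 2) ≤ (N * p) ^ 2 * B := by
    have e : (fun x => X x ^ 2) = fun x => ∑ S ∈ P, ∑ T ∈ P,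
        if Disjoint (pairsIn S ∪ pairsIn T) x then (1 : ℝ) else 0 := by
      funext x
      rw [hX, sq, Finset.sum_mul_sum]
      refine Finset.sum_congr rfl fun S _ => Finset.sum_congr rfl fun T _ => ?_
      simp only [ite_zero_mul_ite_zero, Finset.disjoint_union_left, one_mul]
    have e2 : ∀ S ∈ P, ∀ T ∈ P, cubeMean (fun x => if Disjoint (pairsIn S ∪ pairsIn T) x
        then (1 : ℝ) else 0) = p ^ 2 * 2 ^ (S ∩ T).card.choose 2 := by
      intro S hS T hT
      rw [← density_eq_cubeMean, density_disjoint, hp, ← card_pairsIn]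
      have hi : pairsIn (S ∩ T) = pairsIn S ∩ pairsIn T := by
        ext e
        induction e with
        | _ a b =>
          simp only [mk_mem_pairsIn, Finset.mem_inter]
          tauto
      have := Finset.card_union_add_card_inter (pairsIn S) (pairsIn T)
      rw [card_pairsIn S, card_pairsIn T, (Finset.mem_powersetCard.1 hS).2,
        (Finset.mem_powersetCard.1 hT).2, ← two_mul, mul_comm 2] at this
      rw [hi, inv_pow, ← pow_mul, ← this, pow_add]
      field_simp
    rw [e, cubeMean_sum]
    calc _ = ∑ S ∈ P, p ^ 2 * ∑ T ∈ P, (2 : ℝ) ^ (S ∩ T).card.choose 2 := by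
          refine Finset.sum_congr rfl fun S hS => ?_
          rw [cubeMean_sum, Finset.mul_sum]
          exact Finset.sum_congr rfl fun T hT => e2 S hS T hT
      _ ≤ ∑ S ∈ P, p ^ 2 * (N * B) := by
          refine Finset.sum_le_sum fun S hS => ?_
          refine mul_le_mul_of_nonneg_left ?_ (by positivity)
          have := sum_two_pow_choose_card_inter_le hk hV S (Finset.mem_powersetCard.1 hS).2
          rw [hN, hPc]
          exact this
      _ = _ := by rw [Finset.sum_const, nsmul_eq_mul]; ring
  have h3 : (N * p) ^ 2 * density (fun x : Finset (Sym2 V) =>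
      ∀ S : Finset V, S.card = k → ¬ Disjoint (pairsIn S) x)
      ≤ cubeMean fun x => (X x - N * p) ^ 2 := by
    rw [density_eq_cubeMean]
    unfold cubeMean
    rw [← mul_div_assoc, Finset.mul_sum]
    gcongr with x
    split_ifs with hx
    · have : X x = 0 := Finset.sum_eq_zero fun S hS => by
        rw [if_neg (hx S (Finset.mem_powersetCard.1 hS).2)]
      simp [this]
    · rw [mul_zero]; positivity
  have h4 : (cubeMean fun x => (X x - N * p) ^ 2) = cubeMean (fun x => X x ^ 2) - (N * p) ^ 2 := by
    have : (fun x => (X x - N * p) ^ 2) = fun x => X x ^ 2 - 2 * (N * p) * X x + (N * p) ^ 2 := by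
      funext x; ring
    have h5 : ∑ x, X x = N * p * 2 ^ Fintype.card (Sym2 V) := by
      rw [← h1, cubeMean]; field_simp
    rw [this]
    unfold cubeMean
    rw [Finset.sum_add_distrib, Finset.sum_sub_distrib, ← Finset.mul_sum, h5, Finset.sum_const,
      Finset.card_univ, Fintype.card_finset, nsmul_eq_mul]
    push_cast
    field_simp
    ring
  have h6 := h3.trans (h4.le.trans (sub_le_sub_right h2 _))
  have h7 : (0 : ℝ) < (N * p) ^ 2 := by positivity
  refine le_of_mul_le_mul_left (h6.trans_eq ?_) h7
  ring

end SecondMoment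

section UpperBound

lemma tendsto_logb_two_natCast : Tendsto (fun n : ℕ => Real.logb 2 n) atTop atTop :=
  (Real.tendsto_logb_atTop (by norm_num)).comp tendsto_natCast_atTop_atTop

lemma tendsto_logb_two_div_self : Tendsto (fun l : ℝ => Real.logb 2 l / l) atTop (𝓝 0) := by
  have h := (Real.isLittleO_log_id_atTop.tendsto_div_nhds_zero).div_const (Real.log 2)
  rw [zero_div] at h
  refine h.congr fun l => ?_
  rw [Real.logb, id]
  ring

/-- An order of independent sets that almost every graph on `n = 2 ^ l` vertices attains. -/
noncomputable def indepOrder (l : ℝ) : ℕ := ⌊2 * l - 6 * Real.logb 2 l⌋₊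

lemma eventually_six_mul_logb_le : ∀ᶠ l : ℝ in atTop, 1 ≤ l ∧ 6 * Real.logb 2 l ≤ 2 * l := by
  have h1 := tendsto_logb_two_div_self.eventually (gt_mem_nhds (show (0 : ℝ) < 1 / 3 by norm_num))
  filter_upwards [h1, eventually_ge_atTop 1] with l h1 h2
  refine ⟨h2, ?_⟩
  rw [div_lt_iff₀ (by linarith)] at h1
  linarith

lemma tendsto_indepOrder_div : Tendsto (fun l => (indepOrder l : ℝ) / l) atTop (𝓝 2) := by
  have hlow : Tendsto (fun l : ℝ => 2 - 6 * (Real.logb 2 l / l) - 1 / l) atTop (𝓝 2) := by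
    have h := (tendsto_logb_two_div_self.const_mul 6).const_sub 2
    have h' := h.sub (tendsto_const_nhds.div_atTop (a := (1 : ℝ)) tendsto_id)
    simpa using h'
  refine tendsto_of_tendsto_of_tendsto_of_le_of_le' hlow tendsto_const_nhds ?_ ?_
  · filter_upwards [eventually_ge_atTop (1 : ℝ)] with l hl
    rw [le_div_iff₀ (by linarith)]
    have : (2 - 6 * (Real.logb 2 l / l) - 1 / l) * l = 2 * l - 6 * Real.logb 2 l - 1 := by
      field_simp
    rw [this]
    exact (Nat.sub_one_lt_floor _).le
  · filter_upwards [eventually_six_mul_logb_le] with l hl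
    rw [div_le_iff₀ (by linarith)]
    refine (Nat.floor_le (by linarith)).trans ?_
    linarith [Real.logb_nonneg one_lt_two hl.1]

lemma tendsto_density_of_eventually_le {V : ℕ → Type*} [∀ n, Fintype (V n)]
    (p : ∀ n, Finset (V n) → Prop) (b : ℕ → ℝ) (hb : Tendsto b atTop (𝓝 0))
    (h : ∀ᶠ n in atTop, density (fun x => ¬ p n x) ≤ b n) :
    Tendsto (fun n => density (p n)) atTop (𝓝 1) := by
  have h1 : Tendsto (fun n => 1 - b n) atTop (𝓝 1) := by simpa using hb.const_sub 1
  refine tendsto_of_tendsto_of_tendsto_of_le_of_le' h1 tendsto_const_nhds ?_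
    (Eventually.of_forall fun n => density_le_one _)
  filter_upwards [h] with n hn
  rw [density_not] at hn
  linarith

theorem tendsto_bipartitionNumber_le : ∃ δ : ℕ → ℝ, Tendsto δ atTop (𝓝 0) ∧
    Tendsto (fun n : ℕ => (randomGraphHalf n).real
      {G | (bipartitionNumber G : ℝ) ≤ n - (2 + δ n) * Real.logb 2 n}) atTop (𝓝 1) := by
  refine ⟨fun n => (indepOrder (Real.logb 2 n) : ℝ) / Real.logb 2 n - 2, ?_, ?_⟩
  · simpa using (tendsto_indepOrder_div.comp tendsto_logb_two_natCast).sub_const 2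
  simp_rw [randomGraphHalf_real]
  have hb : Tendsto (fun n : ℕ => Real.exp (4 / Real.logb 2 n) - 1) atTop (𝓝 0) := by
    have h := (tendsto_const_nhds (x := (4 : ℝ))).div_atTop tendsto_logb_two_natCast
    simpa using ((Real.continuous_exp.tendsto 0).comp h).sub_const 1
  refine tendsto_density_of_eventually_le _ _ hb ?_
  have hn : ∀ᶠ n : ℕ in atTop, 2 * Real.logb 2 n ≤ n := by
    have h1 := (tendsto_logb_two_div_self.comp tendsto_natCast_atTop_atTop).eventually
      (gt_mem_nhds (show (0 : ℝ) < 1 / 2 by norm_num))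
    filter_upwards [h1, eventually_ge_atTop 1] with n h1 h2
    have : (0 : ℝ) < n := by exact_mod_cast h2
    simp only [Function.comp] at h1
    rw [div_lt_iff₀ this] at h1
    linarith
  filter_upwards [hn, tendsto_logb_two_natCast.eventually eventually_six_mul_logb_le,
    eventually_ge_atTop 1] with n hn hl hn1
  set l := Real.logb 2 n with hldef
  set k := indepOrder l with hk
  have hlog : 0 ≤ Real.logb 2 l := Real.logb_nonneg one_lt_two hl.1
  have hl0 : 0 < l := by linarith
  have hn0 : (0 : ℝ) < n := by exact_mod_cast hn1
  have hk1 : (k : ℝ) ≤ 2 * l - 6 * Real.logb 2 l := Nat.floor_le (by linarith)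
  have hkn : k ≤ n := by
    have : (k : ℝ) ≤ n := by linarith
    exact_mod_cast this
  have h2k : (2 : ℝ) ^ ((k : ℝ) / 2) ≤ n / l ^ 3 := by
    calc (2 : ℝ) ^ ((k : ℝ) / 2) ≤ 2 ^ (l - Real.logb 2 l * 3) :=
          Real.rpow_le_rpow_of_exponent_le (by norm_num) (by linarith)
      _ = n / l ^ 3 := by
          rw [Real.rpow_sub (by norm_num), Real.rpow_mul (by norm_num),
            Real.rpow_logb (by norm_num) (by norm_num) hl0, hldef,
            Real.rpow_logb (by norm_num) (by norm_num) hn0]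
          norm_cast
  have hbound : (k : ℝ) ^ 2 * (2 : ℝ) ^ ((k : ℝ) / 2) / n ≤ 4 / l := by
    calc (k : ℝ) ^ 2 * (2 : ℝ) ^ ((k : ℝ) / 2) / n ≤ (2 * l) ^ 2 * (n / l ^ 3) / n := by
          gcongr
          linarith
      _ = 4 / l := by field_simp; norm_num
  have hmain := density_no_indep_le (V := Fin n) (k := k) (by simpa using hkn)
    (by rw [Fintype.card_fin]; omega)
  rw [Fintype.card_fin] at hmain
  refine le_trans (density_mono fun x hx S hS hdis => hx ?_)
    (hmain.trans (sub_le_sub_right (Real.exp_le_exp.2 hbound) 1))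
  have hle := bipartitionNumber_le_of_isIndepSet (SimpleGraph.fromEdgeSet (x : Set _)) S
    (fun u hu v hv huv => by
      rw [SimpleGraph.fromEdgeSet_adj] at huv
      exact Finset.disjoint_left.1 hdis (mk_mem_pairsIn.2 ⟨hu, hv, huv.2⟩) huv.1)
  rw [hS] at hle
  have h5 : (2 + ((k : ℝ) / l - 2)) * l = k := by field_simp; ring
  rw [h5]
  have h6 : (bipartitionNumber (SimpleGraph.fromEdgeSet (x : Set (Sym2 (Fin n)))) : ℝ)
      ≤ ((n - k : ℕ) : ℝ) := by exact_mod_cast hle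
  rwa [Nat.cast_sub hkn] at h6

end UpperBound

section Blocked

variable {V ι : Type*}

/-- No biclique with `u` on the side `F i` and `v` on the other side lies in the graph with edge
set `x`. -/
def HalfBlocked (F : ι → Finset V) (x : Finset (Sym2 V)) (u v : V) : Prop :=
  ∀ i, u ∈ F i → v ∉ F i → ∃ w ∈ F i, w ≠ u ∧ s(v, w) ∉ x

/-- The edge `uv` lies in no biclique of the graph with edge set `x` having one of the sets `F i`
as a side. -/
def Blocked (F : ι → Finset V) (x : Finset (Sym2 V)) (u v : V) : Prop :=
  u ≠ v ∧ s(u, v) ∈ x ∧ HalfBlocked F x u v ∧ HalfBlocked F x v u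

/-- The status of the unordered pair `e` may influence whether `uv` is blocked. -/
def Influences (F : ι → Finset V) (e : Sym2 V) (u v : V) : Prop :=
  e = s(u, v) ∨ (∃ i, u ∈ F i ∧ ∃ w ∈ F i, e = s(v, w)) ∨ ∃ i, v ∈ F i ∧ ∃ w ∈ F i, e = s(u, w)

variable [DecidableEq V]

lemma mem_symmDiff_singleton_of_ne {E : Type*} [DecidableEq E] {x : Finset E} {e f : E}
    (h : e ≠ f) : f ∈ symmDiff x {e} ↔ f ∈ x := by
  simp [Finset.mem_symmDiff, h.symm]

lemma halfBlocked_symmDiff {F : ι → Finset V} {x : Finset (Sym2 V)} {e : Sym2 V} {u v : V}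
    (h : ∀ i, u ∈ F i → ∀ w ∈ F i, e ≠ s(v, w)) :
    HalfBlocked F (symmDiff x {e}) u v ↔ HalfBlocked F x u v := by
  refine forall_congr' fun i => imp_congr_right fun hu => imp_congr_right fun _ =>
    exists_congr fun w => and_congr_right fun hw => and_congr_right fun _ => not_congr ?_
  exact mem_symmDiff_singleton_of_ne (h i hu w hw)

lemma blocked_symmDiff {F : ι → Finset V} {x : Finset (Sym2 V)} {e : Sym2 V} {u v : V}
    (h : ¬ Influences F e u v) : Blocked F (symmDiff x {e}) u v ↔ Blocked F x u v := by
  unfold Influences at h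
  push Not at h
  obtain ⟨h1, h2, h3⟩ := h
  unfold Blocked
  rw [halfBlocked_symmDiff h2, halfBlocked_symmDiff h3, mem_symmDiff_singleton_of_ne h1]

open scoped Classical in
/-- The number of ordered pairs in `W` that are blocked edges. -/
noncomputable def blockedCount (F : ι → Finset V) (W : Finset V) (x : Finset (Sym2 V)) : ℝ :=
  ((W ×ˢ W).filter fun p => Blocked F x p.1 p.2).card

open scoped Classical in
/-- The number of ordered pairs in `W` that `e` influences. -/
noncomputable def influence (F : ι → Finset V) (W : Finset V) (e : Sym2 V) : ℝ :=
  ((W ×ˢ W).filter fun p => Influences F e p.1 p.2).card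

lemma abs_blockedCount_sub_le (F : ι → Finset V) (W : Finset V) (e : Sym2 V)
    (x : Finset (Sym2 V)) :
    |blockedCount F W x - blockedCount F W (symmDiff x {e})| ≤ influence F W e := by
  classical
  have aux : ∀ y z : Finset (Sym2 V), (∀ u v, ¬ Influences F e u v →
      (Blocked F y u v → Blocked F z u v)) →
      blockedCount F W y ≤ blockedCount F W z + influence F W e := by
    intro y z h
    unfold blockedCount influence
    rw [← Nat.cast_add, Nat.cast_le]
    refine le_trans (Finset.card_le_card ?_) (Finset.card_union_le _ _)
    intro p hp
    rw [Finset.mem_union, Finset.mem_filter, Finset.mem_filter]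
    rw [Finset.mem_filter] at hp
    by_cases hi : Influences F e p.1 p.2
    · exact Or.inr ⟨hp.1, hi⟩
    · exact Or.inl ⟨hp.1, h _ _ hi hp.2⟩
  have h1 := aux x (symmDiff x {e}) fun u v h hb => (blocked_symmDiff h).2 hb
  have h2 := aux (symmDiff x {e}) x fun u v h hb => (blocked_symmDiff h).1 hb
  rw [abs_le]
  constructor <;> linarith

variable [Fintype ι]

/-- The number of sets `F i` containing `y`. -/
def setDegree (F : ι → Finset V) (y : V) : ℕ := (Finset.univ.filter fun i => y ∈ F i).card

/-- The expected number of sets `F i ∋ u` for which `F i \ {u}` lies in a random set. -/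
noncomputable def setWeight (F : ι → Finset V) (u : V) : ℝ :=
  ∑ i ∈ Finset.univ.filter fun i => u ∈ F i, ((2 : ℝ) ^ ((F i).card - 1))⁻¹

lemma sum_mul_filter_mem (F : ι → Finset V) (W : Finset V) (hF : ∀ i, F i ⊆ W) (f : ι → ℝ) :
    ∑ u ∈ W, ∑ i ∈ Finset.univ.filter (fun i => u ∈ F i), f i = ∑ i, (F i).card * f i := by
  simp_rw [Finset.sum_filter]
  rw [Finset.sum_comm]
  refine Finset.sum_congr rfl fun i _ => ?_
  rw [← Finset.sum_filter, Finset.sum_const, nsmul_eq_mul, Finset.filter_mem_eq_inter,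
    Finset.inter_eq_right.2 (hF i)]

lemma sum_setDegree (F : ι → Finset V) (W : Finset V) (hF : ∀ i, F i ⊆ W) :
    ∑ u ∈ W, (setDegree F u : ℝ) = ∑ i, ((F i).card : ℝ) := by
  have h := sum_mul_filter_mem F W hF fun _ => 1
  simpa [setDegree] using h

lemma sum_setWeight_le (F : ι → Finset V) (W : Finset V) (hF : ∀ i, F i ⊆ W) :
    ∑ u ∈ W, setWeight F u ≤ Fintype.card ι := by
  unfold setWeight
  rw [sum_mul_filter_mem F W hF]
  refine (Finset.sum_le_card_nsmul _ _ 1 fun i _ => ?_).trans_eq (by simp)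
  rw [← div_eq_mul_inv, div_le_one (by positivity)]
  have h : (F i).card - 1 < 2 ^ ((F i).card - 1) := Nat.lt_two_pow_self
  exact_mod_cast (by omega : (F i).card ≤ 2 ^ ((F i).card - 1))

lemma card_filter_setWeight_le (F : ι → Finset V) (W : Finset V) (hF : ∀ i, F i ⊆ W)
    (hW : W.card = Fintype.card ι) :
    (W.card : ℝ) / 2 ≤ (W.filter fun u => setWeight F u ≤ 2).card := by
  have hnn : ∀ u, 0 ≤ setWeight F u := fun u => Finset.sum_nonneg fun i _ => by positivity
  have h1 : ((W.filter fun u => ¬ setWeight F u ≤ 2).card : ℝ) * 2 ≤ W.card := by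
    rw [← nsmul_eq_mul]
    refine (Finset.card_nsmul_le_sum _ (setWeight F) 2 fun u hu => ?_).trans
      (le_trans ?_ ((sum_setWeight_le F W hF).trans_eq (by rw [hW])))
    · exact (not_le.1 (Finset.mem_filter.1 hu).2).le
    · exact Finset.sum_le_sum_of_subset_of_nonneg (Finset.filter_subset _ _) fun u _ _ => hnn u
  have h2 : ((W.filter fun u => setWeight F u ≤ 2).card : ℝ)
      + (W.filter fun u => ¬ setWeight F u ≤ 2).card = W.card := by
    exact_mod_cast Finset.card_filter_add_card_filter_not (s := W) fun u => setWeight F u ≤ 2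
  linarith

lemma card_biUnion_filter_mem_le (F : ι → Finset V) {t : ℕ} (ht : ∀ i, (F i).card ≤ t) (y : V) :
    ((Finset.univ.filter fun i => y ∈ F i).biUnion F).card ≤ setDegree F y * t :=
  Finset.card_biUnion_le_card_mul _ _ _ fun i _ => ht i

lemma influence_le (F : ι → Finset V) (W : Finset V) {t : ℕ} (ht : ∀ i, (F i).card ≤ t) {D : ℝ}
    (hD : ∀ y, setDegree F y ≤ D) (e : Sym2 V) : influence F W e ≤ 2 + 4 * (D * t) := by
  classical
  induction e with
  | _ a b =>
    set U : V → Finset V := fun y => (Finset.univ.filter fun i => y ∈ F i).biUnion F with hU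
    have hUc : ∀ y, ((U y).card : ℝ) ≤ D * t := fun y => by
      refine le_trans (b := ((setDegree F y * t : ℕ) : ℝ))
        (by exact_mod_cast card_biUnion_filter_mem_le F ht y) ?_
      rw [Nat.cast_mul]
      exact mul_le_mul_of_nonneg_right (hD y) (by positivity)
    have hsub : ((W ×ˢ W).filter fun p => Influences F s(a, b) p.1 p.2)
        ⊆ {(a, b), (b, a)} ∪ ((U b).image (fun u => (u, a)) ∪ ((U a).image (fun u => (u, b))
          ∪ ((U b).image (fun v => (a, v)) ∪ (U a).image (fun v => (b, v))))) := by
      rintro ⟨u, v⟩ hp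
      have hp : Influences F s(a, b) u v := (Finset.mem_filter.1 hp).2
      simp only [Finset.mem_union, Finset.mem_insert, Finset.mem_singleton, Prod.mk.injEq,
        Finset.mem_image, hU, Finset.mem_biUnion, Finset.mem_filter, Finset.mem_univ, true_and]
      rcases hp with h | ⟨i, hu, w, hw, h⟩ | ⟨i, hv, w, hw, h⟩
      · rcases Sym2.eq_iff.1 h with ⟨rfl, rfl⟩ | ⟨rfl, rfl⟩ <;> simp
      · rcases Sym2.eq_iff.1 h with ⟨rfl, rfl⟩ | ⟨rfl, rfl⟩
        · exact Or.inr (Or.inl ⟨u, ⟨i, hw, hu⟩, rfl, rfl⟩)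
        · exact Or.inr (Or.inr (Or.inl ⟨u, ⟨i, hw, hu⟩, rfl, rfl⟩))
      · rcases Sym2.eq_iff.1 h with ⟨rfl, rfl⟩ | ⟨rfl, rfl⟩
        · exact Or.inr (Or.inr (Or.inr (Or.inl ⟨v, ⟨i, hw, hv⟩, rfl, rfl⟩)))
        · exact Or.inr (Or.inr (Or.inr (Or.inr ⟨v, ⟨i, hw, hv⟩, rfl, rfl⟩)))
    have hcard := (Finset.card_le_card hsub).trans ((Finset.card_union_le _ _).trans
      (Nat.add_le_add Finset.card_le_two ((Finset.card_union_le _ _).trans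
        (Nat.add_le_add Finset.card_image_le ((Finset.card_union_le _ _).trans
          (Nat.add_le_add Finset.card_image_le ((Finset.card_union_le _ _).trans
            (Nat.add_le_add Finset.card_image_le Finset.card_image_le))))))))
    have hcard' : influence F W s(a, b)
        ≤ ((2 + ((U b).card + ((U a).card + ((U b).card + (U a).card))) : ℕ) : ℝ) := by
      unfold influence
      exact Nat.cast_le.2 hcard
    simp only [Nat.cast_add, Nat.cast_ofNat] at hcard'
    linarith [hUc a, hUc b]

variable [Fintype V]

lemma le_density_blocked (F : ι → Finset V) (hF : ∀ i, (F i).card ≠ 1) {u v : V} (huv : u ≠ v)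
    (hu : setWeight F u ≤ 2) (hv : setWeight F v ≤ 2) :
    1 / 512 ≤ density fun x => Blocked F x u v := by
  classical
  set T : ι ⊕ ι → Finset (Sym2 V) := Sum.elim (fun i => ((F i).erase u).image fun w => s(v, w))
    (fun i => ((F i).erase v).image fun w => s(u, w)) with hT
  set S : Finset (ι ⊕ ι) := (Finset.univ.filter fun i => u ∈ F i ∧ v ∉ F i).disjSum
    (Finset.univ.filter fun i => v ∈ F i ∧ u ∉ F i) with hS
  have hinj : ∀ a : V, Function.Injective fun w => s(a, w) := fun a w w' h =>
    Sym2.congr_right.1 h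
  have hcard : ∀ a b i, a ∈ F i → (((F i).erase a).image fun w => s(b, w)).card
      = (F i).card - 1 := fun a b i ha => by
    rw [Finset.card_image_of_injective _ (hinj b), Finset.card_erase_of_mem ha]
  have hne : ∀ a b i, a ∈ F i → (((F i).erase a).image fun w => s(b, w)).Nonempty := by
    intro a b i ha
    rw [← Finset.card_pos, hcard a b i ha]
    have := Finset.card_pos.2 ⟨a, ha⟩
    have := hF i
    omega
  have key := le_density_mem_and_forall_not_subset S T s(u, v) (by
      rintro (i | i) hi
      · simp only [hS, Finset.inl_mem_disjSum, Finset.mem_filter] at hi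
        exact hne u v i hi.2.1
      · simp only [hS, Finset.inr_mem_disjSum, Finset.mem_filter] at hi
        exact hne v u i hi.2.1) (by
      rintro (i | i) hi
      · simp only [hS, Finset.inl_mem_disjSum, Finset.mem_filter] at hi
        simp only [hT, Sum.elim_inl, Finset.mem_image, Finset.mem_erase, Sym2.eq_iff]
        rintro ⟨w, ⟨hw, hw'⟩, ⟨h1, h2⟩ | ⟨h1, h2⟩⟩
        · exact huv h1.symm
        · exact hw h2
      · simp only [hS, Finset.inr_mem_disjSum, Finset.mem_filter] at hi
        simp only [hT, Sum.elim_inr, Finset.mem_image, Finset.mem_erase, Sym2.eq_iff]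
        rintro ⟨w, ⟨hw, hw'⟩, ⟨h1, h2⟩ | ⟨h1, h2⟩⟩
        · exact hw h2
        · exact huv h1)
  have hsum : ∑ i ∈ S, ((2 : ℝ) ^ (T i).card)⁻¹ ≤ 4 := by
    rw [hS, Finset.sum_disjSum]
    have aux : ∀ a b : V, ∑ i ∈ Finset.univ.filter (fun i => a ∈ F i ∧ b ∉ F i),
        ((2 : ℝ) ^ (((F i).erase a).image fun w => s(b, w)).card)⁻¹ ≤ setWeight F a := by
      intro a b
      rw [Finset.sum_congr rfl fun i hi => by
        rw [hcard a b i (Finset.mem_filter.1 hi).2.1]]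
      refine Finset.sum_le_sum_of_subset_of_nonneg ?_ fun i _ _ => by positivity
      intro i hi
      simp only [Finset.mem_filter] at hi ⊢
      exact ⟨hi.1, hi.2.1⟩
    have h1 := aux u v
    have h2 := aux v u
    simp only [hT, Sum.elim_inl, Sum.elim_inr]
    linarith
  calc (1 : ℝ) / 512 = 4 ^ (-4 : ℝ) / 2 := by
        rw [Real.rpow_neg (by norm_num)]
        norm_num
    _ ≤ (4 : ℝ) ^ (-∑ i ∈ S, ((2 : ℝ) ^ (T i).card)⁻¹) / 2 := by
        gcongr
        norm_num
    _ ≤ _ := key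
    _ ≤ _ := by
        refine density_mono fun x hx => ⟨huv, hx.1, fun i hi hi' => ?_, fun i hi hi' => ?_⟩
        · have h := hx.2 (Sum.inl i) (by simp [hS, hi, hi'])
          rw [Finset.not_subset] at h
          obtain ⟨e, he, hex⟩ := h
          simp only [hT, Sum.elim_inl, Finset.mem_image, Finset.mem_erase] at he
          obtain ⟨w, hw, rfl⟩ := he
          exact ⟨w, hw.2, hw.1, hex⟩
        · have h := hx.2 (Sum.inr i) (by simp [hS, hi, hi'])
          rw [Finset.not_subset] at h
          obtain ⟨e, he, hex⟩ := h
          simp only [hT, Sum.elim_inr, Finset.mem_image, Finset.mem_erase] at he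
          obtain ⟨w, hw, rfl⟩ := he
          exact ⟨w, hw.2, hw.1, hex⟩

lemma le_cubeMean_blockedCount (F : ι → Finset V) (W : Finset V) (hFW : ∀ i, F i ⊆ W)
    (hF : ∀ i, (F i).card ≠ 1) (hW : W.card = Fintype.card ι) (h4 : 4 ≤ W.card) :
    (W.card : ℝ) ^ 2 / 4096 ≤ cubeMean (blockedCount F W) := by
  classical
  set X := W.filter fun u => setWeight F u ≤ 2 with hX
  have hXc : (W.card : ℝ) / 2 ≤ X.card := card_filter_setWeight_le F W hFW hW
  have e : blockedCount F W = fun x => ∑ p ∈ W ×ˢ W, if Blocked F x p.1 p.2 then (1 : ℝ) else 0 := by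
    funext x
    rw [Finset.sum_boole, blockedCount]
  have h1 : X.offDiag.card • (1 / 512 : ℝ)
      ≤ ∑ p ∈ W ×ˢ W, density fun x => Blocked F x p.1 p.2 := by
    refine (Finset.card_nsmul_le_sum X.offDiag _ _ fun p hp => ?_).trans
      (Finset.sum_le_sum_of_subset_of_nonneg ?_ fun p _ _ => density_nonneg _)
    · rw [Finset.mem_offDiag, hX, Finset.mem_filter, Finset.mem_filter] at hp
      exact le_density_blocked F hF hp.2.2 hp.1.2 hp.2.1.2
    · intro p hp
      rw [Finset.mem_offDiag, hX, Finset.mem_filter, Finset.mem_filter] at hp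
      exact Finset.mem_product.2 ⟨hp.1.1, hp.2.1.1⟩
  have h2 : (X.offDiag.card : ℝ) = X.card * X.card - X.card := by
    rw [Finset.offDiag_card, Nat.cast_sub (Nat.le_mul_self _), Nat.cast_mul]
  have h4' : (4 : ℝ) ≤ W.card := by exact_mod_cast h4
  rw [e, cubeMean_sum]
  simp_rw [← density_eq_cubeMean]
  refine le_trans ?_ h1
  rw [nsmul_eq_mul, h2]
  nlinarith

lemma sum_influence_le (F : ι → Finset V) (W : Finset V) (hFW : ∀ i, F i ⊆ W)
    (hW : W.card = Fintype.card ι) {t : ℕ} (ht : ∀ i, (F i).card ≤ t) (ht1 : 1 ≤ t) :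
    ∑ e, influence F W e ≤ 3 * (W.card : ℝ) ^ 2 * t ^ 2 := by
  classical
  set U : V → Finset V := fun y => (Finset.univ.filter fun i => y ∈ F i).biUnion F with hU
  have hswap : ∑ e, influence F W e
      = ∑ p ∈ W ×ˢ W, ((Finset.univ.filter fun e => Influences F e p.1 p.2).card : ℝ) := by
    simp_rw [influence, Finset.card_filter, Nat.cast_sum]
    exact Finset.sum_comm
  have hterm : ∀ u v : V, ((Finset.univ.filter fun e => Influences F e u v).card : ℝ)
      ≤ 1 + (setDegree F u * t + setDegree F v * t) := by
    intro u v
    have hsub : (Finset.univ.filter fun e => Influences F e u v)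
        ⊆ {s(u, v)} ∪ ((U u).image (fun w => s(v, w)) ∪ (U v).image fun w => s(u, w)) := by
      intro e he
      have he : Influences F e u v := (Finset.mem_filter.1 he).2
      simp only [Finset.mem_union, Finset.mem_singleton,
        Finset.mem_image, hU, Finset.mem_biUnion, Finset.mem_filter, Finset.mem_univ, true_and]
      rcases he with h | ⟨i, hu, w, hw, h⟩ | ⟨i, hv, w, hw, h⟩
      · exact Or.inl h
      · exact Or.inr (Or.inl ⟨w, ⟨i, hu, hw⟩, h.symm⟩)
      · exact Or.inr (Or.inr ⟨w, ⟨i, hv, hw⟩, h.symm⟩)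
    have hcard := (Finset.card_le_card hsub).trans ((Finset.card_union_le _ _).trans
      (Nat.add_le_add (Finset.card_singleton _).le ((Finset.card_union_le _ _).trans
        (Nat.add_le_add
          (Finset.card_image_le.trans (card_biUnion_filter_mem_le F ht u))
          (Finset.card_image_le.trans (card_biUnion_filter_mem_le F ht v))))))
    exact_mod_cast hcard
  have hdeg : ∑ u ∈ W, (setDegree F u : ℝ) ≤ W.card * t := by
    rw [sum_setDegree F W hFW, hW]
    refine (Finset.sum_le_card_nsmul _ _ (t : ℝ) fun i _ => by exact_mod_cast ht i).trans_eq ?_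
    simp
  have ht1' : (1 : ℝ) ≤ t := by exact_mod_cast ht1
  rw [hswap]
  calc _ ≤ ∑ p ∈ W ×ˢ W, (1 + ((setDegree F p.1 : ℝ) * t + setDegree F p.2 * t)) :=
        Finset.sum_le_sum fun p _ => hterm p.1 p.2
    _ = (W.card : ℝ) ^ 2 + 2 * (W.card * ((∑ u ∈ W, (setDegree F u : ℝ)) * t)) := by
        rw [Finset.sum_product]
        simp only [Finset.sum_add_distrib, Finset.sum_const, nsmul_eq_mul, ← Finset.sum_mul,
          ← Finset.mul_sum]
        ring
    _ ≤ (W.card : ℝ) ^ 2 + 2 * (W.card * ((W.card * t) * t)) := by gcongr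
    _ ≤ _ := by nlinarith [sq_nonneg (W.card : ℝ), mul_le_mul ht1' ht1' zero_le_one (by linarith)]

/-- With overwhelming probability a positive proportion of the pairs are blocked edges. -/
theorem density_blockedCount_le (F : ι → Finset V) (W : Finset V) (hFW : ∀ i, F i ⊆ W)
    (hF : ∀ i, (F i).card ≠ 1) (hW : W.card = Fintype.card ι) (h4 : 4 ≤ W.card) {t : ℕ}
    (ht : ∀ i, (F i).card ≤ t) (ht1 : 1 ≤ t) {D : ℝ} (hD1 : 1 ≤ D)
    (hD : ∀ y, setDegree F y ≤ D) :
    density (fun x => blockedCount F W x ≤ (W.card : ℝ) ^ 2 / 8192)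
      ≤ Real.exp (-((W.card : ℝ) ^ 2 / (2 ^ 30 * t ^ 3 * D))) := by
  have ht1' : (1 : ℝ) ≤ t := by exact_mod_cast ht1
  have h4' : (4 : ℝ) ≤ W.card := by exact_mod_cast h4
  have hc0 : ∀ e, 0 ≤ influence F W e := fun e => Nat.cast_nonneg _
  have hDt : 1 ≤ D * t := one_le_mul_of_one_le_of_one_le hD1 ht1'
  have hsum : ∑ e, influence F W e ^ 2 ≤ 18 * (W.card : ℝ) ^ 2 * t ^ 3 * D := by
    calc ∑ e, influence F W e ^ 2 ≤ ∑ e, (6 * (D * t)) * influence F W e := by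
          refine Finset.sum_le_sum fun e _ => ?_
          rw [sq]
          refine mul_le_mul_of_nonneg_right ?_ (hc0 e)
          linarith [influence_le F W ht hD e]
      _ = (6 * (D * t)) * ∑ e, influence F W e := by rw [Finset.mul_sum]
      _ ≤ (6 * (D * t)) * (3 * (W.card : ℝ) ^ 2 * t ^ 2) := by
          refine mul_le_mul_of_nonneg_left (sum_influence_le F W hFW hW ht ht1) (by positivity)
      _ = _ := by ring
  have key := density_le_cubeMean_sub_le (influence F W) (blockedCount F W)
    (fun e x => abs_blockedCount_sub_le F W e x) (s := (W.card : ℝ) ^ 2 / 8192)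
    (by positivity) (by positivity) hsum
  refine (density_mono fun x hx => ?_).trans (key.trans (Real.exp_le_exp.2 (neg_le_neg ?_)))
  · have := le_cubeMean_blockedCount F W hFW hF hW h4
    linarith
  · rw [div_le_div_iff₀ (by positivity) (by positivity)]
    have e1 : 2 * ((W.card : ℝ) ^ 2 / 8192) ^ 2 * (2 ^ 30 * t ^ 3 * D)
        = 32 * ((W.card : ℝ) ^ 4 * t ^ 3 * D) := by ring
    have e2 : (W.card : ℝ) ^ 2 * (18 * (W.card : ℝ) ^ 2 * t ^ 3 * D)
        = 18 * ((W.card : ℝ) ^ 4 * t ^ 3 * D) := by ring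
    rw [e1, e2]
    gcongr
    norm_num

end Blocked

section UnionBounds

variable {V : Type*} [DecidableEq V]

/-- The edges of the complete bipartite graph with parts `A` and `B`. -/
def bicliqueEdges (A B : Finset V) : Finset (Sym2 V) := (A ×ˢ B).image fun p => s(p.1, p.2)

lemma mem_bicliqueEdges {A B : Finset V} {u v : V} :
    s(u, v) ∈ bicliqueEdges A B ↔ (u ∈ A ∧ v ∈ B) ∨ (u ∈ B ∧ v ∈ A) := by
  simp only [bicliqueEdges, Finset.mem_image, Finset.mem_product, Prod.exists, Sym2.eq_iff]
  constructor
  · rintro ⟨a, b, ⟨ha, hb⟩, ⟨rfl, rfl⟩ | ⟨rfl, rfl⟩⟩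
    · exact Or.inl ⟨ha, hb⟩
    · exact Or.inr ⟨hb, ha⟩
  · rintro (⟨hu, hv⟩ | ⟨hu, hv⟩)
    · exact ⟨u, v, ⟨hu, hv⟩, Or.inl ⟨rfl, rfl⟩⟩
    · exact ⟨v, u, ⟨hv, hu⟩, Or.inr ⟨rfl, rfl⟩⟩

lemma card_bicliqueEdges {A B : Finset V} (h : Disjoint A B) :
    (bicliqueEdges A B).card = A.card * B.card := by
  rw [bicliqueEdges, Finset.card_image_of_injOn, Finset.card_product]
  rintro ⟨a, b⟩ hab ⟨a', b'⟩ hab' heq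
  simp only [Finset.coe_product, Set.mem_prod, Finset.mem_coe] at hab hab'
  rcases Sym2.eq_iff.1 heq with ⟨rfl, rfl⟩ | ⟨rfl, rfl⟩
  · rfl
  · exact absurd hab'.2 (Finset.disjoint_left.1 h hab.1)

/-- The edge-disjoint bicliques `f i`, with sides of sizes `t` and `q`, lie in `x`. -/
def IsBicliquePacking (t q : ℕ) {r : ℕ} (f : Fin r → Finset V × Finset V) (W : Finset V)
    (x : Finset (Sym2 V)) : Prop :=
  (∀ i, (f i).1.card = t ∧ (f i).2.card = q ∧ (f i).2 ⊆ W ∧ Disjoint (f i).1 (f i).2) ∧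
  (∀ i j, i ≠ j → Disjoint (bicliqueEdges (f i).1 (f i).2) (bicliqueEdges (f j).1 (f j).2)) ∧
  ∀ i, bicliqueEdges (f i).1 (f i).2 ⊆ x

variable [Fintype V]

lemma density_exists_biclique_le (L : ℕ) :
    density (fun x : Finset (Sym2 V) => ∃ A B : Finset V, Disjoint A B ∧ A.card = L ∧ B.card = L ∧
      bicliqueEdges A B ⊆ x) ≤ (Fintype.card V : ℝ) ^ (2 * L) * (2 ^ (L * L))⁻¹ := by
  classical
  set s := (Finset.univ.powersetCard L : Finset (Finset V)) ×ˢ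
    (Finset.univ.powersetCard L : Finset (Finset V)) with hs
  have hcard : (s.card : ℝ) ≤ (Fintype.card V : ℝ) ^ (2 * L) := by
    rw [hs, Finset.card_product, Finset.card_powersetCard, Finset.card_univ, two_mul, pow_add]
    push_cast
    have h : ((Fintype.card V).choose L : ℝ) ≤ (Fintype.card V : ℝ) ^ L := by
      exact_mod_cast Nat.choose_le_pow _ _
    gcongr
  refine (density_mono (p' := fun x => ∃ p ∈ s, Disjoint p.1 p.2 ∧ bicliqueEdges p.1 p.2 ⊆ x)
    ?_).trans ((density_exists_le_card_mul s _ (b := (2 ^ (L * L))⁻¹) ?_).trans ?_)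
  · rintro x ⟨A, B, hd, hA, hB, hx⟩
    exact ⟨(A, B), by simp [hs, Finset.mem_powersetCard, hA, hB], hd, hx⟩
  · rintro ⟨A, B⟩ hAB
    simp only [hs, Finset.mem_product, Finset.mem_powersetCard] at hAB
    by_cases hd : Disjoint A B
    · refine (density_mono fun x hx => hx.2).trans ?_
      rw [density_superset, card_bicliqueEdges hd, hAB.1.2, hAB.2.2]
    · refine le_trans (density_mono (p' := fun x => False) fun x hx => hd hx.1) ?_
      simp [density]
  · gcongr

lemma density_exists_packing_le (t q r m : ℕ) :
    density (fun x : Finset (Sym2 V) => ∃ W : Finset V, W.card = m ∧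
      ∃ f : Fin r → Finset V × Finset V, IsBicliquePacking t q f W x)
      ≤ (Fintype.card V : ℝ) ^ m * (((Fintype.card V : ℝ) ^ t * m.choose q) ^ r
        * (2 ^ (r * (t * q)))⁻¹) := by
  classical
  have hfix : ∀ W : Finset V, W.card = m → density (fun x : Finset (Sym2 V) =>
      ∃ f : Fin r → Finset V × Finset V, IsBicliquePacking t q f W x)
      ≤ ((Fintype.card V : ℝ) ^ t * m.choose q) ^ r * (2 ^ (r * (t * q)))⁻¹ := by
    intro W hW
    set s : Finset (Fin r → Finset V × Finset V) := Fintype.piFinset fun _ =>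
      (Finset.univ.powersetCard t : Finset (Finset V)) ×ˢ W.powersetCard q with hs
    have hcard : (s.card : ℝ) ≤ ((Fintype.card V : ℝ) ^ t * m.choose q) ^ r := by
      rw [hs, Fintype.card_piFinset, Finset.prod_const, Finset.card_univ, Fintype.card_fin,
        Finset.card_product, Finset.card_powersetCard, Finset.card_powersetCard, Finset.card_univ,
        hW]
      push_cast
      have h : ((Fintype.card V).choose t : ℝ) ≤ (Fintype.card V : ℝ) ^ t := by
        exact_mod_cast Nat.choose_le_pow _ _
      gcongr
    refine (density_mono (p' := fun x => ∃ f ∈ s, IsBicliquePacking t q f W x)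
      ?_).trans ((density_exists_le_card_mul s _ (b := (2 ^ (r * (t * q)))⁻¹) ?_).trans ?_)
    · rintro x ⟨f, hf⟩
      refine ⟨f, ?_, hf⟩
      rw [hs, Fintype.mem_piFinset]
      intro i
      rw [Finset.mem_product, Finset.mem_powersetCard, Finset.mem_powersetCard]
      exact ⟨⟨Finset.subset_univ _, (hf.1 i).1⟩, (hf.1 i).2.2.1, (hf.1 i).2.1⟩
    · intro f _
      by_cases hf : (∀ i, (f i).1.card = t ∧ (f i).2.card = q ∧ (f i).2 ⊆ W ∧
          Disjoint (f i).1 (f i).2) ∧ (∀ i j, i ≠ j →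
          Disjoint (bicliqueEdges (f i).1 (f i).2) (bicliqueEdges (f j).1 (f j).2))
      · refine (density_mono (p' := fun x => (Finset.univ.biUnion fun i =>
          bicliqueEdges (f i).1 (f i).2) ⊆ x) fun x hx => ?_).trans ?_
        · exact Finset.biUnion_subset.2 fun i _ => hx.2.2 i
        · rw [density_superset, Finset.card_biUnion fun i _ j _ hij => hf.2 i j hij,
            Finset.sum_congr rfl fun i _ => by
              rw [card_bicliqueEdges (hf.1 i).2.2.2, (hf.1 i).1, (hf.1 i).2.1]]
          simp
      · refine le_trans (density_mono (p' := fun x => False) fun x hx => hf ⟨hx.1, hx.2.1⟩) ?_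
        simp [density]
    · gcongr
  refine (density_mono (p' := fun x => ∃ W ∈ (Finset.univ.powersetCard m : Finset (Finset V)),
    ∃ f : Fin r → Finset V × Finset V, IsBicliquePacking t q f W x) ?_).trans
    ((density_exists_le_card_mul _ _ fun W hW => hfix W (Finset.mem_powersetCard.1 hW).2).trans ?_)
  · rintro x ⟨W, hW, hx⟩
    exact ⟨W, by simp [Finset.mem_powersetCard, hW], hx⟩
  · rw [Finset.card_powersetCard, Finset.card_univ]
    have h : ((Fintype.card V).choose m : ℝ) ≤ (Fintype.card V : ℝ) ^ m := by
      exact_mod_cast Nat.choose_le_pow _ _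
    gcongr

lemma card_filter_card_le (t : ℕ) :
    (Finset.univ.filter fun s : Finset V => s.card ≤ t).card ≤ (Fintype.card V + 1) ^ t := by
  classical
  have h : (Finset.univ.filter fun s : Finset V => s.card ≤ t)
      ⊆ (Finset.univ : Finset (Fin t → Option V)).image
        fun f => Finset.univ.filter fun v => ∃ i, f i = some v := by
    intro s hs
    rw [Finset.mem_filter] at hs
    rw [Finset.mem_image]
    refine ⟨fun i => if h : i.1 < s.card then some (s.equivFin.symm ⟨i, h⟩).1 else none,
      Finset.mem_univ _, ?_⟩
    ext v
    simp only [Finset.mem_filter, Finset.mem_univ, true_and]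
    constructor
    · rintro ⟨i, hi⟩
      split_ifs at hi with h
      rw [← Option.some_injective _ hi]
      exact (s.equivFin.symm ⟨i, h⟩).2
    · intro hv
      set j := s.equivFin ⟨v, hv⟩ with hj
      refine ⟨⟨j, j.2.trans_le hs.2⟩, ?_⟩
      simp [hj]
  refine (Finset.card_le_card h).trans (Finset.card_image_le.trans_eq ?_)
  simp

/-- `F` is a family of small subsets of `W`, none a singleton, with small degrees. -/
structure IsSmallFamily (t : ℕ) (g : ℝ) (W : Finset V) (F : Fin W.card → Finset V) : Prop where
  subset : ∀ i, F i ⊆ W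
  card_ne_one : ∀ i, (F i).card ≠ 1
  card_le : ∀ i, (F i).card ≤ t
  degree_le : ∀ y, (setDegree F y : ℝ) ≤ W.card / g

lemma density_exists_family_le {t m : ℕ} {g : ℝ} (ht : 1 ≤ t) (hg : 0 < g) (hm : 4 ≤ m)
    (hgm : g ≤ m) :
    density (fun x : Finset (Sym2 V) => ∃ W : Finset V, W.card = m ∧
      ∃ F : Fin W.card → Finset V, IsSmallFamily t g W F ∧
        blockedCount F W x ≤ (W.card : ℝ) ^ 2 / 8192)
      ≤ (Fintype.card V : ℝ) ^ m * (((Fintype.card V + 1 : ℝ) ^ t) ^ m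
        * Real.exp (-(m * g / (2 ^ 30 * t ^ 3)))) := by
  classical
  have hfix : ∀ W : Finset V, W.card = m → density (fun x : Finset (Sym2 V) =>
      ∃ F : Fin W.card → Finset V, IsSmallFamily t g W F ∧
        blockedCount F W x ≤ (W.card : ℝ) ^ 2 / 8192)
      ≤ ((Fintype.card V + 1 : ℝ) ^ t) ^ m * Real.exp (-(m * g / (2 ^ 30 * t ^ 3))) := by
    rintro W rfl
    set s : Finset (Fin W.card → Finset V) := Fintype.piFinset fun _ =>
      Finset.univ.filter fun s : Finset V => s.card ≤ t with hs
    have hcard : (s.card : ℝ) ≤ ((Fintype.card V + 1 : ℝ) ^ t) ^ W.card := by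
      rw [hs, Fintype.card_piFinset, Finset.prod_const, Finset.card_univ, Fintype.card_fin]
      exact_mod_cast Nat.pow_le_pow_left (card_filter_card_le t) _
    refine (density_mono (p' := fun x => ∃ F ∈ s, IsSmallFamily t g W F ∧
      blockedCount F W x ≤ (W.card : ℝ) ^ 2 / 8192) ?_).trans
      ((density_exists_le_card_mul s _
        (b := Real.exp (-(W.card * g / (2 ^ 30 * t ^ 3)))) ?_).trans ?_)
    · rintro x ⟨F, hF, hx⟩
      refine ⟨F, ?_, hF, hx⟩
      rw [hs, Fintype.mem_piFinset]
      exact fun i => Finset.mem_filter.2 ⟨Finset.mem_univ _, hF.card_le i⟩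
    · intro F _
      by_cases hF : IsSmallFamily t g W F
      · refine (density_mono fun x hx => hx.2).trans ?_
        have hm0 : (0 : ℝ) < W.card := by exact_mod_cast (by omega : 0 < W.card)
        refine (density_blockedCount_le F W hF.subset hF.card_ne_one (by simp) hm hF.card_le ht
          (D := W.card / g) ((one_le_div hg).2 hgm) hF.degree_le).trans_eq ?_
        congr 2
        have : (0 : ℝ) < t := by exact_mod_cast ht
        field_simp
      · refine le_trans (density_mono (p' := fun x => False) fun x hx => hF hx.1) ?_
        simp only [density, Finset.filter_false, Finset.card_empty, Nat.cast_zero, zero_div]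
        positivity
    · gcongr
  refine (density_mono (p' := fun x => ∃ W ∈ (Finset.univ.powersetCard m : Finset (Finset V)),
    ∃ F : Fin W.card → Finset V, IsSmallFamily t g W F ∧
        blockedCount F W x ≤ (W.card : ℝ) ^ 2 / 8192) ?_).trans
    ((density_exists_le_card_mul _ _ fun W hW => hfix W (Finset.mem_powersetCard.1 hW).2).trans ?_)
  · rintro x ⟨W, hW, hx⟩
    exact ⟨W, by simp [Finset.mem_powersetCard, hW], hx⟩
  · rw [Finset.card_powersetCard, Finset.card_univ]
    have h : ((Fintype.card V).choose m : ℝ) ≤ (Fintype.card V : ℝ) ^ m := by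
      exact_mod_cast Nat.choose_le_pow _ _
    gcongr

end UnionBounds

section NumericalBounds

lemma Nat.cast_choose_le_three_mul_div_pow {m q : ℕ} (hq : 1 ≤ q) :
    (m.choose q : ℝ) ≤ (3 * m / q) ^ q := by
  have hq0 : (0 : ℝ) < q := by exact_mod_cast hq
  have h1 := Real.pow_div_factorial_le_exp (q : ℝ) hq0.le q
  have h2 : Real.exp q ≤ 3 ^ q := by
    rw [← Real.exp_one_pow]
    gcongr
    exact (Real.exp_one_lt_d9.trans (by norm_num)).le
  have h3 : (m.choose q : ℝ) ≤ (m : ℝ) ^ q / q.factorial := Nat.choose_le_pow_div q m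
  calc (m.choose q : ℝ) ≤ (m : ℝ) ^ q / q.factorial := h3
    _ = (m / q : ℝ) ^ q * ((q : ℝ) ^ q / q.factorial) := by
        rw [div_pow]; field_simp
    _ ≤ (m / q : ℝ) ^ q * 3 ^ q := by gcongr; exact h1.trans h2
    _ = _ := by rw [← mul_pow]; congr 1; ring

lemma two_rpow_mul_logb_natCast {n : ℕ} (hn : 1 ≤ n) (k : ℕ) :
    (2 : ℝ) ^ (k * Real.logb 2 n) = (n : ℝ) ^ k := by
  rw [mul_comm, Real.rpow_mul (by norm_num), Real.rpow_logb (by norm_num) (by norm_num)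
    (by exact_mod_cast hn), Real.rpow_natCast]

lemma biclique_bound {n L : ℕ} (hn : 2 ≤ n) (hL : 3 * Real.logb 2 n ≤ L) :
    (n : ℝ) ^ (2 * L) * (2 ^ (L * L))⁻¹ ≤ (n : ℝ)⁻¹ := by
  have hl : 1 ≤ Real.logb 2 n := by
    rw [Real.le_logb_iff_rpow_le one_lt_two (by positivity), Real.rpow_one]
    exact_mod_cast hn
  rw [← pow_one (n : ℝ)⁻¹, inv_pow, ← two_rpow_mul_logb_natCast (by omega),
    ← two_rpow_mul_logb_natCast (by omega), ← Real.rpow_natCast, ← Real.rpow_neg (by norm_num),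
    ← Real.rpow_neg (by norm_num), ← Real.rpow_add (by norm_num)]
  refine Real.rpow_le_rpow_of_exponent_le (by norm_num) ?_
  push_cast
  nlinarith

lemma le_div_of_cube_le {L m : ℕ} (hL : 1 ≤ L) (hm : 2 ^ 35 * L ^ 3 ≤ m) :
    (m : ℝ) ≤ 2 ^ 17 * L * (m / (2 ^ 16 * L) : ℕ) ∧ 1 ≤ m / (2 ^ 16 * L) := by
  have h16 : 2 ^ 16 * L ≤ m := by
    refine le_trans ?_ hm
    have : L ≤ L ^ 3 := Nat.le_self_pow (by norm_num) L
    omega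
  have hq1 : 1 ≤ m / (2 ^ 16 * L) := (Nat.one_le_div_iff (by omega)).2 h16
  refine ⟨?_, hq1⟩
  have h := Nat.lt_div_mul_add (a := m) (b := 2 ^ 16 * L) (by omega)
  have h2 : 2 ^ 16 * L ≤ m / (2 ^ 16 * L) * (2 ^ 16 * L) := Nat.le_mul_of_pos_left _ hq1
  have h3 : m ≤ 2 ^ 17 * L * (m / (2 ^ 16 * L)) := by
    calc m ≤ m / (2 ^ 16 * L) * (2 ^ 16 * L) + m / (2 ^ 16 * L) * (2 ^ 16 * L) := by omega
      _ = _ := by ring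
  exact_mod_cast h3

lemma packing_bound {n L t m : ℕ} (hn : 2 ≤ n) (hL : 3 * Real.logb 2 n ≤ L) (ht : 1 ≤ t)
    (htL : (2 : ℝ) ^ 19 * L ≤ 2 ^ ((t : ℝ) / 4)) (hm : 2 ^ 35 * L ^ 3 ≤ m) :
    (n : ℝ) ^ m * (((n : ℝ) ^ t * m.choose (m / (2 ^ 16 * L))) ^ (2 ^ 19 * L ^ 2)
      * (2 ^ (2 ^ 19 * L ^ 2 * (t * (m / (2 ^ 16 * L)))))⁻¹) ≤ ((n : ℝ) ^ m)⁻¹ := by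
  have hl : 1 ≤ Real.logb 2 n := by
    rw [Real.le_logb_iff_rpow_le one_lt_two (by positivity), Real.rpow_one]
    exact_mod_cast hn
  have hLr : (1 : ℝ) ≤ L := by linarith
  have hL1 : 1 ≤ L := by exact_mod_cast hLr
  obtain ⟨hmq, hq1⟩ := le_div_of_cube_le hL1 hm
  set q := m / (2 ^ 16 * L) with hq
  set r := 2 ^ 19 * L ^ 2 with hr
  set l := Real.logb 2 n with hldef
  have hq0 : (1 : ℝ) ≤ q := by exact_mod_cast hq1
  have hmr : (2 : ℝ) ^ 35 * L ^ 3 ≤ m := by exact_mod_cast hm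
  have hql : 4 * l ≤ q := by
    have h1 : (2 : ℝ) ^ 17 * L * (2 ^ 18 * L ^ 2) ≤ 2 ^ 17 * L * q := by
      refine le_trans (le_of_eq ?_) (hmr.trans hmq)
      ring
    have h2 : (2 : ℝ) ^ 18 * L ^ 2 ≤ q := le_of_mul_le_mul_left h1 (by positivity)
    nlinarith
  have ht0 : (1 : ℝ) ≤ t := by exact_mod_cast ht
  have hch : (m.choose q : ℝ) ≤ 2 ^ ((t : ℝ) / 4 * q) := by
    refine (Nat.cast_choose_le_three_mul_div_pow hq1).trans ?_
    rw [Real.rpow_mul (by norm_num), Real.rpow_natCast]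
    refine pow_le_pow_left₀ (by positivity) (le_trans ?_ htL) _
    rw [div_le_iff₀ (by linarith)]
    nlinarith
  have hnt : (n : ℝ) ^ t ≤ 2 ^ ((t : ℝ) / 4 * q) := by
    rw [← two_rpow_mul_logb_natCast (by omega)]
    refine Real.rpow_le_rpow_of_exponent_le (by norm_num) ?_
    nlinarith
  have hrr : (r : ℝ) = 2 ^ 19 * L ^ 2 := by rw [hr]; push_cast; ring
  have hrq : 4 * l * m ≤ r * q := by
    rw [hrr]
    calc 4 * l * m ≤ 4 * L * (2 ^ 17 * L * q) := by
          gcongr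
          linarith
      _ = _ := by ring
  have hrq0 : 0 ≤ (r : ℝ) * q := by positivity
  calc _ ≤ (n : ℝ) ^ m * (((2 : ℝ) ^ ((t : ℝ) / 4 * q) * 2 ^ ((t : ℝ) / 4 * q)) ^ r
        * (2 ^ (r * (t * q)))⁻¹) := by gcongr
    _ = (2 : ℝ) ^ (m * l + (((t : ℝ) / 4 * q + (t : ℝ) / 4 * q) * r + -(r * (t * q)))) := by
        rw [← two_rpow_mul_logb_natCast (by omega), ← Real.rpow_add (by norm_num),
          ← Real.rpow_natCast _ r, ← Real.rpow_mul (by norm_num), ← Real.rpow_natCast 2,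
          ← Real.rpow_neg (by norm_num), ← Real.rpow_add (by norm_num),
          ← Real.rpow_add (by norm_num)]
        push_cast
        rfl
    _ ≤ (2 : ℝ) ^ (-(m * l)) := by
        refine Real.rpow_le_rpow_of_exponent_le (by norm_num) ?_
        nlinarith [mul_nonneg hrq0 (sub_nonneg.2 ht0)]
    _ = _ := by rw [Real.rpow_neg (by norm_num), two_rpow_mul_logb_natCast (by omega)]

lemma family_bound {n t m : ℕ} (ht : 1 ≤ t) (hn : 1 ≤ n) :
    (n : ℝ) ^ m * (((n + 1 : ℝ) ^ t) ^ m
        * Real.exp (-(m * (2 ^ 32 * t ^ 4 * Real.log (n + 1)) / (2 ^ 30 * t ^ 3))))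
      ≤ ((n : ℝ) ^ m)⁻¹ := by
  have ht0 : (0 : ℝ) < t := by exact_mod_cast ht
  have hn0 : (0 : ℝ) < n := by exact_mod_cast hn
  have h1 : m * (2 ^ 32 * (t : ℝ) ^ 4 * Real.log (n + 1)) / (2 ^ 30 * t ^ 3)
      = (4 * m * t : ℕ) * Real.log (n + 1) := by
    push_cast
    field_simp
    ring
  rw [h1, Real.exp_neg, Real.exp_nat_mul, Real.exp_log (by positivity), ← pow_mul,
    ← mul_assoc, mul_inv_le_iff₀ (by positivity), inv_mul_eq_div, le_div_iff₀ (by positivity)]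
  calc (n : ℝ) ^ m * (n + 1) ^ (t * m) * n ^ m
      ≤ (n + 1 : ℝ) ^ (t * m) * (n + 1) ^ (t * m) * (n + 1) ^ (t * m) := by
        have h2 : (n : ℝ) ^ m ≤ (n + 1 : ℝ) ^ (t * m) := by
          calc (n : ℝ) ^ m ≤ (n + 1 : ℝ) ^ m := by gcongr; linarith
            _ ≤ _ := pow_le_pow_right₀ (by linarith) (Nat.le_mul_of_pos_left _ ht)
        gcongr
    _ = (n + 1 : ℝ) ^ (3 * (t * m)) := by ring
    _ ≤ _ := pow_le_pow_right₀ (by linarith) (by nlinarith [Nat.zero_le (t * m)])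

lemma density_exists_card_le {V : Type*} [Fintype V] {p : Finset V → Finset (Sym2 V) → Prop} {m₀ : ℕ} (hm₀ : 2 ≤ m₀)
    (hV : 2 ≤ Fintype.card V)
    (h : ∀ m, m₀ ≤ m → density (fun x => ∃ W : Finset V, W.card = m ∧ p W x)
      ≤ ((Fintype.card V : ℝ) ^ m)⁻¹) :
    density (fun x => ∃ W : Finset V, m₀ ≤ W.card ∧ p W x) ≤ (Fintype.card V : ℝ)⁻¹ := by
  have hV' : (1 : ℝ) ≤ Fintype.card V := by exact_mod_cast (by omega : 1 ≤ Fintype.card V)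
  refine (density_mono (p' := fun x => ∃ m ∈ Finset.Icc m₀ (Fintype.card V),
    ∃ W : Finset V, W.card = m ∧ p W x) ?_).trans
    ((density_exists_le_card_mul _ _ (b := ((Fintype.card V : ℝ) ^ 2)⁻¹) fun m hm => ?_).trans ?_)
  · rintro x ⟨W, hW, hx⟩
    exact ⟨W.card, Finset.mem_Icc.2 ⟨hW, Finset.card_le_univ W⟩, W, rfl, hx⟩
  · rw [Finset.mem_Icc] at hm
    refine (h m hm.1).trans ?_
    gcongr
    exact hm₀.trans hm.1
  · have h1 : ((Finset.Icc m₀ (Fintype.card V)).card : ℝ) ≤ Fintype.card V := by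
      rw [Nat.card_Icc]
      exact_mod_cast (by omega : Fintype.card V + 1 - m₀ ≤ Fintype.card V)
    calc _ ≤ (Fintype.card V : ℝ) * ((Fintype.card V : ℝ) ^ 2)⁻¹ := by gcongr
      _ = _ := by field_simp

end NumericalBounds

section Pseudorandom

variable {V : Type*} [DecidableEq V] [Fintype V]

/-- The properties of the random graph from which the lower bound follows: small bicliques, few
large ones, and many blocked edges for every family of small sets. -/
structure IsPseudorandom (L t : ℕ) (g : ℝ) (x : Finset (Sym2 V)) : Prop where
  no_biclique : ∀ A B : Finset V, Disjoint A B → A.card = L → B.card = L →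
    ¬ bicliqueEdges A B ⊆ x
  no_packing : ∀ W : Finset V, 2 ^ 35 * L ^ 3 ≤ W.card →
    ∀ f : Fin (2 ^ 19 * L ^ 2) → Finset V × Finset V,
      ¬ IsBicliquePacking t (W.card / (2 ^ 16 * L)) f W x
  blocked : ∀ W : Finset V, 2 ^ 35 * L ^ 3 ≤ W.card → ∀ F : Fin W.card → Finset V,
    IsSmallFamily t g W F → (W.card : ℝ) ^ 2 / 8192 < blockedCount F W x

theorem density_not_isPseudorandom_le {L t : ℕ} {g : ℝ} (hV : 2 ≤ Fintype.card V)
    (hL : 3 * Real.logb 2 (Fintype.card V) ≤ L) (ht : 1 ≤ t)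
    (htL : (2 : ℝ) ^ 19 * L ≤ 2 ^ ((t : ℝ) / 4))
    (hg : g = 2 ^ 32 * t ^ 4 * Real.log (Fintype.card V + 1)) (hgL : g ≤ 2 ^ 35 * L ^ 3) :
    density (fun x : Finset (Sym2 V) => ¬ IsPseudorandom L t g x)
      ≤ 3 * (Fintype.card V : ℝ)⁻¹ := by
  have hl : 1 ≤ Real.logb 2 (Fintype.card V) := by
    rw [Real.le_logb_iff_rpow_le one_lt_two (by positivity), Real.rpow_one]
    exact_mod_cast hV
  have hL1 : 1 ≤ L := by
    have : (1 : ℝ) ≤ L := by linarith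
    exact_mod_cast this
  have hL3 : 1 ≤ L ^ 3 := Nat.one_le_pow _ _ hL1
  have ht0 : (0 : ℝ) < t := by exact_mod_cast ht
  have hg0 : 0 < g := by
    have : 0 < Real.log (Fintype.card V + 1 : ℝ) := Real.log_pos (by
      have : (2 : ℝ) ≤ Fintype.card V := by exact_mod_cast hV
      linarith)
    rw [hg]; positivity
  have h1 := (density_exists_biclique_le (V := V) L).trans (biclique_bound hV hL)
  have h2 := density_exists_card_le (V := V) (m₀ := 2 ^ 35 * L ^ 3) (by omega) hV
    (p := fun W x => ∃ f : Fin (2 ^ 19 * L ^ 2) → Finset V × Finset V,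
      IsBicliquePacking t (W.card / (2 ^ 16 * L)) f W x) (by
    intro m hm
    refine le_trans (density_mono ?_) ((density_exists_packing_le (V := V) t (m / (2 ^ 16 * L))
      (2 ^ 19 * L ^ 2) m).trans (packing_bound hV hL ht htL hm))
    rintro x ⟨W, rfl, hx⟩
    exact ⟨W, rfl, hx⟩)
  have h3 := density_exists_card_le (V := V) (m₀ := 2 ^ 35 * L ^ 3) (by omega) hV
    (p := fun W x => ∃ F : Fin W.card → Finset V, IsSmallFamily t g W F ∧
        blockedCount F W x ≤ (W.card : ℝ) ^ 2 / 8192) (by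
    intro m hm
    have hm' : (2 : ℝ) ^ 35 * L ^ 3 ≤ m := by exact_mod_cast hm
    refine (density_exists_family_le ht hg0 (by omega) (hgL.trans hm')).trans ?_
    rw [hg]
    exact family_bound ht (by omega))
  refine (density_mono fun x hx => ?_).trans ((density_or_le _ _).trans
    ((add_le_add h1 ((density_or_le _ _).trans (add_le_add h2 h3))).trans_eq (by ring)))
  by_contra hcon
  push Not at hcon
  obtain ⟨c1, c2, c3⟩ := hcon
  exact hx ⟨c1, c2, c3⟩

end Pseudorandom

section Deterministic

lemma exists_enumeration {ι : Type*} [DecidableEq ι] (I : Finset ι) {m : ℕ} (h : I.card ≤ m) :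
    ∃ τ : Fin m → Option ι, (∀ i ∈ I, ∃ j, τ j = some i) ∧ (∀ j, ∀ i, τ j = some i → i ∈ I) ∧
      ∀ j j' i, τ j = some i → τ j' = some i → j = j' := by
  refine ⟨fun j => if h : j.1 < I.card then some (I.equivFin.symm ⟨j, h⟩).1 else none,
    fun i hi => ⟨⟨I.equivFin ⟨i, hi⟩, (I.equivFin ⟨i, hi⟩).2.trans_le h⟩, by simp⟩,
    fun j i hj => ?_, fun j j' i hj hj' => ?_⟩
  · dsimp only at hj
    split_ifs at hj with hlt
    rw [← Option.some_injective _ hj]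
    exact (I.equivFin.symm ⟨j, hlt⟩).2
  · dsimp only at hj hj'
    split_ifs at hj with hlt
    split_ifs at hj' with hlt'
    have h1 := Option.some_injective _ (hj.trans hj'.symm)
    have h2 := I.equivFin.symm.injective (Subtype.ext h1)
    exact Fin.ext (by simpa using h2)

variable {V ι : Type*} [DecidableEq V]

/-- The smaller of the two parts `P` and `Q` inside `W`. -/
def smallSide (P Q W : Finset V) : Finset V :=
  if (P ∩ W).card ≤ (Q ∩ W).card then P ∩ W else Q ∩ W

/-- The larger of the two parts `P` and `Q` inside `W`. -/
def largeSide (P Q W : Finset V) : Finset V :=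
  if (P ∩ W).card ≤ (Q ∩ W).card then Q ∩ W else P ∩ W

lemma card_smallSide (P Q W : Finset V) :
    (smallSide P Q W).card = min (P ∩ W).card (Q ∩ W).card := by
  unfold smallSide
  split_ifs <;> omega

lemma card_smallSide_le_card_largeSide (P Q W : Finset V) :
    (smallSide P Q W).card ≤ (largeSide P Q W).card := by
  unfold smallSide largeSide
  split_ifs <;> omega

lemma smallSide_subset (P Q W : Finset V) : smallSide P Q W ⊆ W := by
  unfold smallSide
  split_ifs <;> exact Finset.inter_subset_right

lemma largeSide_subset (P Q W : Finset V) : largeSide P Q W ⊆ W := by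
  unfold largeSide
  split_ifs <;> exact Finset.inter_subset_right

lemma disjoint_smallSide_largeSide {P Q : Finset V} (h : Disjoint P Q) (W : Finset V) :
    Disjoint (smallSide P Q W) (largeSide P Q W) := by
  unfold smallSide largeSide
  split_ifs
  · exact h.mono Finset.inter_subset_left Finset.inter_subset_left
  · exact h.symm.mono Finset.inter_subset_left Finset.inter_subset_left

lemma mem_bicliqueEdges_sides {P Q W : Finset V} {u v : V} (hu : u ∈ W) (hv : v ∈ W) :
    s(u, v) ∈ bicliqueEdges (smallSide P Q W) (largeSide P Q W)
      ↔ s(u, v) ∈ bicliqueEdges P Q := by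
  rw [mem_bicliqueEdges, mem_bicliqueEdges]
  unfold smallSide largeSide
  split_ifs <;> simp only [Finset.mem_inter, hu, hv, and_true]
  tauto

lemma bicliqueEdges_mono {A B P Q : Finset V} (hA : A ⊆ P) (hB : B ⊆ Q) :
    bicliqueEdges A B ⊆ bicliqueEdges P Q :=
  Finset.image_subset_image (Finset.product_subset_product hA hB)

lemma bicliqueEdges_sides_subset (P Q W : Finset V) :
    bicliqueEdges (smallSide P Q W) (largeSide P Q W) ⊆ bicliqueEdges P Q := by
  intro e
  induction e with
  | _ u v =>
    intro h
    have h' := mem_bicliqueEdges.1 h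
    have hs := smallSide_subset P Q W
    have hl := largeSide_subset P Q W
    refine (mem_bicliqueEdges_sides (W := W) ?_ ?_).1 h
    · exact h'.elim (fun h => hs h.1) fun h => hl h.1
    · exact h'.elim (fun h => hl h.2) fun h => hs h.2

/-- Complete bipartite graphs with parts `P i` and `Q i` partition the edges in `x`. -/
structure IsPartition (P Q : ι → Finset V) (x : Finset (Sym2 V)) : Prop where
  disjoint_sides : ∀ i, Disjoint (P i) (Q i)
  disjoint_edges : ∀ i j, i ≠ j → Disjoint (bicliqueEdges (P i) (Q i)) (bicliqueEdges (P j) (Q j))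
  mem_iff : ∀ u v, u ≠ v → (s(u, v) ∈ x ↔ ∃ i, s(u, v) ∈ bicliqueEdges (P i) (Q i))

/-- The bicliques with an edge inside `W` all have their index in `I`. -/
def CoversWithin (P Q : ι → Finset V) (W : Finset V) (I : Finset ι) : Prop :=
  ∀ i, ∀ u ∈ W, ∀ v ∈ W, s(u, v) ∈ bicliqueEdges (P i) (Q i) → i ∈ I

lemma IsPartition.bicliqueEdges_subset {P Q : ι → Finset V} {x : Finset (Sym2 V)}
    (h : IsPartition P Q x) (i : ι) : bicliqueEdges (P i) (Q i) ⊆ x := by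
  intro e
  induction e with
  | _ u v =>
    intro he
    have huv : u ≠ v := by
      rintro rfl
      have := Finset.disjoint_left.1 (h.disjoint_sides i)
      rw [mem_bicliqueEdges] at he
      tauto
    exact (h.mem_iff u v huv).2 ⟨i, he⟩

lemma IsPseudorandom.card_smallSide_lt {L t : ℕ} {g : ℝ} {x : Finset (Sym2 V)}
    (hx : IsPseudorandom L t g x) {P Q : Finset V} (hd : Disjoint P Q)
    (hPQ : bicliqueEdges P Q ⊆ x) (W : Finset V) : (smallSide P Q W).card < L := by
  by_contra! h
  obtain ⟨A, hA, hAc⟩ := Finset.exists_subset_card_eq h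
  obtain ⟨B, hB, hBc⟩ := Finset.exists_subset_card_eq
    (h.trans (card_smallSide_le_card_largeSide P Q W))
  exact hx.no_biclique A B ((disjoint_smallSide_largeSide hd W).mono hA hB) hAc hBc
    ((bicliqueEdges_mono hA hB).trans ((bicliqueEdges_sides_subset P Q W).trans hPQ))

lemma IsPseudorandom.card_large_lt {L t : ℕ} {g : ℝ} {x : Finset (Sym2 V)}
    (hx : IsPseudorandom L t g x) {P Q : ι → Finset V} (hP : IsPartition P Q x)
    {W : Finset V} (hW : 2 ^ 35 * L ^ 3 ≤ W.card) (J : Finset ι)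
    (hJt : ∀ i ∈ J, t ≤ (smallSide (P i) (Q i) W).card)
    (hJq : ∀ i ∈ J, W.card / (2 ^ 16 * L) ≤ (largeSide (P i) (Q i) W).card) :
    J.card < 2 ^ 19 * L ^ 2 := by
  by_contra! h
  obtain ⟨J', hJ', hJ'c⟩ := Finset.exists_subset_card_eq h
  set φ := J'.equivFinOfCardEq hJ'c with hφ
  have hA : ∀ j, ∃ A ⊆ smallSide (P (φ.symm j)) (Q (φ.symm j)) W, A.card = t := fun j =>
    Finset.exists_subset_card_eq (hJt _ (hJ' (φ.symm j).2))
  have hB : ∀ j, ∃ B ⊆ largeSide (P (φ.symm j)) (Q (φ.symm j)) W,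
      B.card = W.card / (2 ^ 16 * L) := fun j =>
    Finset.exists_subset_card_eq (hJq _ (hJ' (φ.symm j).2))
  choose A hA hAc using hA
  choose B hB hBc using hB
  have hsub : ∀ j, bicliqueEdges (A j) (B j)
      ⊆ bicliqueEdges (P (φ.symm j)) (Q (φ.symm j)) := fun j =>
    (bicliqueEdges_mono (hA j) (hB j)).trans (bicliqueEdges_sides_subset _ _ W)
  refine hx.no_packing W hW (fun j => (A j, B j)) ⟨fun j => ⟨hAc j, hBc j,
    (hB j).trans (largeSide_subset _ _ W),
    (disjoint_smallSide_largeSide (hP.disjoint_sides _) W).mono (hA j) (hB j)⟩,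
    fun j j' hjj' => ?_, fun j => (hsub j).trans (hP.bicliqueEdges_subset _)⟩
  refine (hP.disjoint_edges _ _ fun h => hjj' ?_).mono (hsub j) (hsub j')
  exact φ.symm.injective (Subtype.ext h)

/-- If fewer than `|W|` bicliques, none a star, partition the edges inside a large set `W`, then
some vertex of `W` lies on the small side of many of them. -/
theorem IsPseudorandom.exists_high_degree [DecidableEq ι] {L t : ℕ} {g : ℝ}
    {x : Finset (Sym2 V)} (hx : IsPseudorandom L t g x) (hg : 0 < g)
    {P Q : ι → Finset V} (hP : IsPartition P Q x)
    {W : Finset V} {I : Finset ι} (hI : CoversWithin P Q W I) (hW : 2 ^ 35 * L ^ 3 ≤ W.card)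
    (hIW : I.card ≤ W.card) (h2 : ∀ i ∈ I, 2 ≤ (smallSide (P i) (Q i) W).card) :
    ∃ y ∈ W, (W.card : ℝ) / g < (I.filter fun i =>
      (smallSide (P i) (Q i) W).card ≤ t ∧ y ∈ smallSide (P i) (Q i) W).card := by
  classical
  by_contra! hcon
  obtain ⟨τ, hτ1, hτ2, hτ3⟩ := exists_enumeration I hIW
  set S : ι → Finset V := fun i => smallSide (P i) (Q i) W with hS
  set O : ι → Finset V := fun i => largeSide (P i) (Q i) W with hO
  set F : Fin W.card → Finset V := fun j =>
    (τ j).elim ∅ fun i => if (S i).card ≤ t then S i else ∅ with hF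
  have hFcase : ∀ j, F j = ∅ ∨ ∃ i ∈ I, τ j = some i ∧ (S i).card ≤ t ∧ F j = S i := by
    intro j
    cases hj : τ j with
    | none => left; simp [hF, hj]
    | some i =>
      by_cases hit : (S i).card ≤ t
      · right; exact ⟨i, hτ2 j i hj, rfl, hit, by simp [hF, hj, hit]⟩
      · left; simp [hF, hj, hit]
  have hsmall : IsSmallFamily t g W F := by
    refine ⟨fun j => ?_, fun j => ?_, fun j => ?_, fun y => ?_⟩
    · rcases hFcase j with h | ⟨i, hi, -, -, h⟩
      · simp [h]
      · rw [h]; exact smallSide_subset _ _ W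
    · rcases hFcase j with h | ⟨i, hi, -, -, h⟩
      · simp [h]
      · rw [h]; have := h2 i hi; simp only [hS]; omega
    · rcases hFcase j with h | ⟨i, hi, -, hit, h⟩
      · simp [h]
      · rw [h]; exact hit
    · by_cases hy : y ∈ W
      · refine le_trans ?_ (hcon y hy)
        rw [Nat.cast_le]
        refine Finset.card_le_card_of_forall_subsingleton (fun j i => τ j = some i) ?_ ?_
        · intro j hj
          rw [Finset.mem_filter] at hj
          rcases hFcase j with h | ⟨i, hi, hji, hit, h⟩
          · rw [h] at hj; simp at hj
          · exact ⟨i, Finset.mem_filter.2 ⟨hi, hit, show y ∈ S i from h ▸ hj.2⟩, hji⟩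
        · intro i _ j hj j' hj'
          exact hτ3 j j' i hj.2 hj'.2
      · have : setDegree F y = 0 := by
          rw [setDegree, Finset.card_eq_zero, Finset.filter_eq_empty_iff]
          intro j _ hj
          rcases hFcase j with h | ⟨i, hi, -, -, h⟩
          · rw [h] at hj; simp at hj
          · rw [h] at hj; exact hy (smallSide_subset _ _ W hj)
        rw [this, Nat.cast_zero]
        positivity
  have hcount := hx.blocked W hW F hsmall
  set K := I.filter fun i => t < (S i).card with hK
  have hsub : ((W ×ˢ W).filter fun p => Blocked F x p.1 p.2)
      ⊆ K.biUnion fun i => S i ×ˢ O i ∪ O i ×ˢ S i := by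
    rintro ⟨u, v⟩ huv
    rw [Finset.mem_filter, Finset.mem_product] at huv
    obtain ⟨⟨hu, hv⟩, hne, hadj, hb1, hb2⟩ := huv
    obtain ⟨i, hi⟩ := (hP.mem_iff u v hne).1 hadj
    have hiI := hI i u hu v hv hi
    rw [← mem_bicliqueEdges_sides hu hv, mem_bicliqueEdges] at hi
    have hdis := Finset.disjoint_left.1 (disjoint_smallSide_largeSide (hP.disjoint_sides i) W)
    have hin : ∀ a ∈ O i, ∀ b ∈ S i, s(a, b) ∈ x := fun a ha b hb =>
      hP.bicliqueEdges_subset i (bicliqueEdges_sides_subset _ _ W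
        (mem_bicliqueEdges.2 (Or.inr ⟨ha, hb⟩)))
    have hbig : t < (S i).card := by
      by_contra! hit
      obtain ⟨j, hj⟩ := hτ1 i hiI
      have hFj : F j = S i := by simp [hF, hj, hit]
      rcases hi with ⟨h1, h2⟩ | ⟨h1, h2⟩
      · obtain ⟨w, hw, -, hw'⟩ := hb1 j (hFj ▸ h1) (fun h => hdis (show v ∈ S i from hFj ▸ h) h2)
        exact hw' (hin v h2 w (hFj ▸ hw))
      · obtain ⟨w, hw, -, hw'⟩ := hb2 j (hFj ▸ h2) (fun h => hdis (show u ∈ S i from hFj ▸ h) h1)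
        exact hw' (hin u h1 w (hFj ▸ hw))
    refine Finset.mem_biUnion.2 ⟨i, Finset.mem_filter.2 ⟨hiI, hbig⟩, ?_⟩
    rw [Finset.mem_union, Finset.mem_product, Finset.mem_product]
    exact hi
  set q := W.card / (2 ^ 16 * L) with hq
  set J := K.filter fun i => q ≤ (O i).card with hJ
  have hJc : J.card < 2 ^ 19 * L ^ 2 := hx.card_large_lt hP hW J
    (fun i hi => (Finset.mem_filter.1 (Finset.mem_filter.1 hi).1).2.le)
    (fun i hi => (Finset.mem_filter.1 hi).2)
  have hSL : ∀ i, (S i).card ≤ L := fun i =>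
    (hx.card_smallSide_lt (hP.disjoint_sides i) (hP.bicliqueEdges_subset i) W).le
  have hOW : ∀ i, (O i).card ≤ W.card := fun i => Finset.card_le_card (largeSide_subset _ _ W)
  have hcard : ((W ×ˢ W).filter fun p => Blocked F x p.1 p.2).card
      ≤ J.card * (2 * L * W.card) + W.card * (2 * L * q) := by
    refine (Finset.card_le_card hsub).trans (Finset.card_biUnion_le.trans ?_)
    have hterm : ∀ i, (S i ×ˢ O i ∪ O i ×ˢ S i).card ≤ 2 * L * (O i).card := fun i => by
      refine (Finset.card_union_le _ _).trans ?_
      rw [Finset.card_product, Finset.card_product]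
      nlinarith [hSL i]
    rw [← Finset.sum_filter_add_sum_filter_not K fun i => q ≤ (O i).card]
    refine add_le_add ?_ ?_
    · rw [← smul_eq_mul]
      exact Finset.sum_le_card_nsmul _ _ _ fun i _ =>
        (hterm i).trans (Nat.mul_le_mul_left _ (hOW i))
    · refine (Finset.sum_le_card_nsmul _ _ (2 * L * q) fun i hi =>
        (hterm i).trans (Nat.mul_le_mul_left _ (not_le.1 (Finset.mem_filter.1 hi).2).le)).trans ?_
      rw [smul_eq_mul]
      exact Nat.mul_le_mul_right _ ((Finset.card_le_card ((Finset.filter_subset _ _).trans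
        (Finset.filter_subset _ _))).trans hIW)
  have hqL : q * (2 ^ 16 * L) ≤ W.card := Nat.div_mul_le_self _ _
  have hq' : (q : ℝ) * (2 ^ 16 * L) ≤ W.card := by exact_mod_cast hqL
  have hW' : (2 : ℝ) ^ 35 * L ^ 3 ≤ W.card := by exact_mod_cast hW
  have hJ' : (J.card : ℝ) ≤ 2 ^ 19 * L ^ 2 := by exact_mod_cast hJc.le
  have hcard' : blockedCount F W x
      ≤ (J.card : ℝ) * (2 * L * W.card) + W.card * (2 * L * q) := by
    unfold blockedCount
    exact_mod_cast hcard
  have hWnn : (0 : ℝ) ≤ W.card := Nat.cast_nonneg _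
  have b1 : (J.card : ℝ) * (2 * L * W.card) ≤ (W.card : ℝ) ^ 2 / 2 ^ 15 := by
    calc (J.card : ℝ) * (2 * L * W.card) ≤ 2 ^ 19 * L ^ 2 * (2 * L * W.card) := by gcongr
      _ = (2 ^ 35 * L ^ 3) * W.card / 2 ^ 15 := by ring
      _ ≤ W.card * W.card / 2 ^ 15 := by gcongr
      _ = _ := by ring
  have b2 : (W.card : ℝ) * (2 * L * q) ≤ (W.card : ℝ) ^ 2 / 2 ^ 15 := by
    calc (W.card : ℝ) * (2 * L * q) = W.card * (q * (2 ^ 16 * L)) / 2 ^ 15 := by ring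
      _ ≤ W.card * W.card / 2 ^ 15 := by gcongr
      _ = _ := by ring
  have b3 : (W.card : ℝ) ^ 2 / 2 ^ 15 + (W.card : ℝ) ^ 2 / 2 ^ 15 ≤ (W.card : ℝ) ^ 2 / 8192 := by
    nlinarith [sq_nonneg (W.card : ℝ)]
  linarith

end Deterministic

section VertexRemoval

variable {V ι : Type*} [DecidableEq V]

/-- The total size of the small sides inside `W`, truncated at `t`. -/
def truncatedSize (P Q : ι → Finset V) (t : ℕ) (W : Finset V) (I : Finset ι) : ℕ :=
  ∑ i ∈ I, min (smallSide (P i) (Q i) W).card t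

lemma truncatedSize_le (P Q : ι → Finset V) (t : ℕ) (W : Finset V) (I : Finset ι) :
    truncatedSize P Q t W I ≤ t * I.card := by
  rw [mul_comm, ← smul_eq_mul]
  exact Finset.sum_le_card_nsmul _ _ _ fun i _ => min_le_right _ _

lemma truncatedSize_mono (P Q : ι → Finset V) (t : ℕ) {W W' : Finset V} {I I' : Finset ι}
    (hW : W' ⊆ W) (hI : I' ⊆ I) : truncatedSize P Q t W' I' ≤ truncatedSize P Q t W I := by
  refine (Finset.sum_le_sum fun i _ => ?_).trans (Finset.sum_le_sum_of_subset hI)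
  rw [card_smallSide, card_smallSide]
  have h1 := Finset.card_le_card (Finset.inter_subset_inter (Finset.Subset.refl (P i)) hW)
  have h2 := Finset.card_le_card (Finset.inter_subset_inter (Finset.Subset.refl (Q i)) hW)
  omega

lemma card_smallSide_erase_lt {P Q W : Finset V} {y : V} (hy : y ∈ smallSide P Q W) :
    (smallSide P Q (W.erase y)).card < (smallSide P Q W).card := by
  rw [card_smallSide, Finset.inter_erase, Finset.inter_erase]
  have hc := card_smallSide P Q W
  unfold smallSide at hy hc ⊢
  split_ifs at hy hc ⊢ with h
  · have := Finset.card_erase_lt_of_mem hy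
    omega
  · have := Finset.card_erase_lt_of_mem hy
    omega

lemma truncatedSize_erase_add_le (P Q : ι → Finset V) (t : ℕ) (W : Finset V) (I : Finset ι)
    (y : V) :
    truncatedSize P Q t (W.erase y) I + (I.filter fun i =>
      (smallSide (P i) (Q i) W).card ≤ t ∧ y ∈ smallSide (P i) (Q i) W).card
      ≤ truncatedSize P Q t W I := by
  unfold truncatedSize
  rw [Finset.card_filter, ← Finset.sum_add_distrib]
  refine Finset.sum_le_sum fun i _ => ?_
  split_ifs with h
  · have := card_smallSide_erase_lt h.2
    omega
  · have h1 := truncatedSize_mono P Q t (Finset.erase_subset y W) (Finset.Subset.refl {i})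
    simpa [truncatedSize] using h1

lemma potential_step {g Φ Φ' t a θ : ℝ} (hg : 0 ≤ g) (ha : 2 ≤ a) (hΦ : Φ ≤ t * a)
    (hθ : 0 ≤ θ) (h : g * Φ' ≤ g * Φ - θ * a) :
    g * Φ' / (a - 1) + θ ≤ g * Φ / a + g * t * (1 / (a - 1)) := by
  have h1 : 0 < a - 1 := by linarith
  have h2 : 0 < a := by linarith
  rw [mul_one_div, ← sub_nonneg]
  have key : g * Φ / a + g * t / (a - 1) - (g * Φ' / (a - 1) + θ)
      = ((g * Φ - θ * a - g * Φ') * a + g * (t * a - Φ) + θ * a) / (a * (a - 1)) := by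
    field_simp
    ring
  rw [key]
  have h3 : 0 ≤ (g * Φ - θ * a - g * Φ') * a := mul_nonneg (by linarith) h2.le
  have h4 : 0 ≤ g * (t * a - Φ) := mul_nonneg hg (by linarith)
  positivity

/-- A vertex set carrying a partition into few bicliques is small up to the potential of the
partition. -/
theorem IsPseudorandom.card_le [DecidableEq ι] {L t : ℕ} {g : ℝ} {x : Finset (Sym2 V)}
    (hx : IsPseudorandom L t g x) (hg : 0 < g) (hL : 1 ≤ L) {P Q : ι → Finset V}
    (hP : IsPartition P Q x) (W : Finset V) (I : Finset ι) (hI : CoversWithin P Q W I) :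
    (W.card : ℝ) ≤ I.card + 2 ^ 35 * L ^ 3 + g * truncatedSize P Q t W I / W.card
      + g * t * ∑ j ∈ Finset.range W.card, 1 / (j : ℝ) := by
  induction hN : W.card + I.card using Nat.strong_induction_on generalizing W I with
  | _ N ih =>
    subst hN
    have hnn1 : 0 ≤ g * truncatedSize P Q t W I / W.card := by positivity
    have hnn2 : 0 ≤ g * t * ∑ j ∈ Finset.range W.card, 1 / (j : ℝ) :=
      mul_nonneg (by positivity) (Finset.sum_nonneg fun j _ => by positivity)
    have hnn3 : (0 : ℝ) ≤ 2 ^ 35 * L ^ 3 := by positivity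
    rcases le_or_gt W.card I.card with hWI | hWI
    · have : (W.card : ℝ) ≤ I.card := by exact_mod_cast hWI
      linarith
    rcases lt_or_ge W.card (2 ^ 35 * L ^ 3) with hW | hW
    · have h1 : (W.card : ℝ) ≤ 2 ^ 35 * L ^ 3 := by exact_mod_cast hW.le
      have h2 : (0 : ℝ) ≤ I.card := Nat.cast_nonneg _
      linarith
    have hW2 : 2 ≤ W.card := by
      have : 1 ≤ L ^ 3 := Nat.one_le_pow _ _ hL
      omega
    have hW2' : (2 : ℝ) ≤ W.card := by exact_mod_cast hW2
    have hΦ : (truncatedSize P Q t W I : ℝ) ≤ t * W.card := by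
      exact_mod_cast (truncatedSize_le P Q t W I).trans (Nat.mul_le_mul_left _ hWI.le)
    have hstep : ∀ (y : V) (I' : Finset ι) (θ : ℝ), y ∈ W → I' ⊆ I → 0 ≤ θ →
        CoversWithin P Q (W.erase y) I' →
        g * truncatedSize P Q t (W.erase y) I' ≤ g * truncatedSize P Q t W I - θ * W.card →
        (W.card : ℝ) + θ ≤ I'.card + 1 + 2 ^ 35 * L ^ 3
          + g * truncatedSize P Q t W I / W.card
          + g * t * ∑ j ∈ Finset.range W.card, 1 / (j : ℝ) := by
      intro y I' θ hy hI'I hθ hI' hθΦ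
      have hc : (W.erase y).card + 1 = W.card := Finset.card_erase_add_one hy
      have hlt : (W.erase y).card + I'.card < W.card + I.card := by
        have := Finset.card_le_card hI'I
        omega
      have h1 := ih _ hlt (W.erase y) I' hI' rfl
      have h2 := potential_step hg.le hW2' hΦ hθ hθΦ
      have hc' : ((W.erase y).card : ℝ) = W.card - 1 := by
        rw [← hc]; push_cast; ring
      have hsum : ∑ j ∈ Finset.range W.card, 1 / (j : ℝ)
          = ∑ j ∈ Finset.range (W.erase y).card, 1 / (j : ℝ) + 1 / ((W.card : ℝ) - 1) := by
        rw [← hc', ← hc, Finset.sum_range_succ]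
      rw [hsum, mul_add]
      rw [hc'] at h1
      linarith
    by_cases h0 : ∃ i ∈ I, (smallSide (P i) (Q i) W).card = 0
    · obtain ⟨i, hi, hi0⟩ := h0
      have hcov : CoversWithin P Q W (I.erase i) := by
        intro j u hu v hv huv
        refine Finset.mem_erase.2 ⟨?_, hI j u hu v hv huv⟩
        rintro rfl
        rw [← mem_bicliqueEdges_sides hu hv, mem_bicliqueEdges, Finset.card_eq_zero.1 hi0] at huv
        simp at huv
      have hc : (I.erase i).card + 1 = I.card := Finset.card_erase_add_one hi
      have h1 := ih _ (by omega) W (I.erase i) hcov rfl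
      have h2 : (truncatedSize P Q t W (I.erase i) : ℝ) ≤ truncatedSize P Q t W I := by
        exact_mod_cast truncatedSize_mono P Q t (Finset.Subset.refl W) (Finset.erase_subset i I)
      have h3 : g * truncatedSize P Q t W (I.erase i) / W.card
          ≤ g * truncatedSize P Q t W I / W.card := by gcongr
      have hc' : ((I.erase i).card : ℝ) + 1 = I.card := by exact_mod_cast hc
      linarith
    by_cases h1 : ∃ i ∈ I, (smallSide (P i) (Q i) W).card = 1
    · obtain ⟨i, hi, hi1⟩ := h1
      obtain ⟨y, hy⟩ := Finset.card_eq_one.1 hi1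
      have hyW : y ∈ W := smallSide_subset (P i) (Q i) W (by rw [hy]; simp)
      have hcov : CoversWithin P Q (W.erase y) (I.erase i) := by
        intro j u hu v hv huv
        rw [Finset.mem_erase] at hu hv
        refine Finset.mem_erase.2 ⟨?_, hI j u hu.2 v hv.2 huv⟩
        rintro rfl
        rw [← mem_bicliqueEdges_sides hu.2 hv.2, mem_bicliqueEdges, hy, Finset.mem_singleton,
          Finset.mem_singleton] at huv
        exact huv.elim (fun h => hu.1 h.1) fun h => hv.1 h.2
      have hmono : (truncatedSize P Q t (W.erase y) (I.erase i) : ℝ) ≤ truncatedSize P Q t W I := by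
        exact_mod_cast truncatedSize_mono P Q t (Finset.erase_subset y W) (Finset.erase_subset i I)
      have h2 := hstep y (I.erase i) 0 hyW (Finset.erase_subset i I) le_rfl hcov
        (by rw [zero_mul, sub_zero]; exact mul_le_mul_of_nonneg_left hmono hg.le)
      have hc' : ((I.erase i).card : ℝ) + 1 = I.card := by
        exact_mod_cast Finset.card_erase_add_one hi
      linarith
    · push Not at h0 h1
      obtain ⟨y, hy, hdeg⟩ := hx.exists_high_degree hg hP hI hW hWI.le fun i hi => by
        have := h0 i hi
        have := h1 i hi
        omega
      rw [div_lt_iff₀ hg] at hdeg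
      have h2 : ((truncatedSize P Q t (W.erase y) I : ℝ) + (I.filter fun i =>
          (smallSide (P i) (Q i) W).card ≤ t ∧ y ∈ smallSide (P i) (Q i) W).card)
          ≤ truncatedSize P Q t W I := by
        exact_mod_cast truncatedSize_erase_add_le P Q t W I y
      have h3 := hstep y I 1 hy (Finset.Subset.refl I) zero_le_one
        (fun j u hu v hv huv => hI j u (Finset.mem_of_mem_erase hu) v (Finset.mem_of_mem_erase hv)
          huv) (by nlinarith)
      linarith

end VertexRemoval

section LowerBound

lemma sum_range_one_div_le (n : ℕ) :
    ∑ j ∈ Finset.range n, 1 / (j : ℝ) ≤ 1 + Real.log n := by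
  cases n with
  | zero => simp
  | succ n =>
    rw [Finset.sum_range_succ']
    have h := harmonic_le_one_add_log n
    have h1 : ((harmonic n : ℚ) : ℝ) = ∑ j ∈ Finset.range n, 1 / ((j + 1 : ℕ) : ℝ) := by
      simp [harmonic]
    rw [h1] at h
    have h2 : Real.log n ≤ Real.log (n + 1 : ℕ) := by
      rcases Nat.eq_zero_or_pos n with rfl | hn
      · simp
      · exact Real.log_le_log (by exact_mod_cast hn) (by push_cast; linarith)
    simp only [Nat.cast_zero, div_zero, add_zero]
    linarith

theorem IsPseudorandom.le_bipartitionNumber {n L t : ℕ} {g : ℝ} {x : Finset (Sym2 (Fin n))}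
    (hx : IsPseudorandom L t g x) (hg : 0 < g) (hL : 1 ≤ L) :
    (n : ℝ) - (2 ^ 35 * L ^ 3 + g * t * (2 + Real.log n))
      ≤ bipartitionNumber (SimpleGraph.fromEdgeSet (x : Set (Sym2 (Fin n)))) := by
  classical
  set G := SimpleGraph.fromEdgeSet (x : Set (Sym2 (Fin n))) with hG
  have hspec := bipartitionNumber_spec G
  set k := bipartitionNumber G with hk
  obtain ⟨H, hH⟩ := hspec
  choose A B hAB hadj using hH.biclique
  set P : Fin k → Finset (Fin n) := fun i => (A i).toFinset with hPdef
  set Q : Fin k → Finset (Fin n) := fun i => (B i).toFinset with hQdef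
  have hmem : ∀ i u v, s(u, v) ∈ bicliqueEdges (P i) (Q i) ↔ (H i).Adj u v := fun i u v => by
    rw [mem_bicliqueEdges, hadj]
    simp [hPdef, hQdef]
  have hP : IsPartition P Q x := by
    refine ⟨fun i => Set.disjoint_toFinset.2 (hAB i), fun i j hij => ?_, fun u v huv => ?_⟩
    · rw [Finset.disjoint_left]
      intro e
      induction e with
      | _ u v =>
        rw [hmem, hmem]
        exact fun h1 h2 => Set.disjoint_left.1 (hH.disjoint i j hij)
          ((SimpleGraph.mem_edgeSet _).2 h1) ((SimpleGraph.mem_edgeSet _).2 h2)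
    · have h1 : s(u, v) ∈ G.edgeSet ↔ s(u, v) ∈ x := by
        simp [hG, huv]
      rw [← h1, ← hH.union, Set.mem_iUnion]
      simp only [hmem, SimpleGraph.mem_edgeSet]
  have key := hx.card_le hg hL hP Finset.univ Finset.univ fun i _ _ _ _ _ => Finset.mem_univ i
  have hΦ := truncatedSize_le P Q t Finset.univ Finset.univ
  rw [Finset.card_univ, Finset.card_univ, Fintype.card_fin, Fintype.card_fin] at key
  rw [Finset.card_univ, Fintype.card_fin] at hΦ
  have hlog : 0 ≤ Real.log n := Real.log_natCast_nonneg n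
  rcases le_or_gt n k with hnk | hnk
  · have h1 : (n : ℝ) ≤ k := by exact_mod_cast hnk
    have h2 : 0 ≤ g * t * (2 + Real.log n) := by positivity
    have h3 : (0 : ℝ) ≤ 2 ^ 35 * L ^ 3 := by positivity
    linarith
  · have hn0 : (0 : ℝ) < n := by exact_mod_cast (by omega : 0 < n)
    have h1 : (truncatedSize P Q t Finset.univ Finset.univ : ℝ) ≤ t * n := by
      exact_mod_cast hΦ.trans (Nat.mul_le_mul_left _ hnk.le)
    have h2 : g * truncatedSize P Q t Finset.univ Finset.univ / n ≤ g * t := by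
      rw [div_le_iff₀ hn0, mul_assoc]
      gcongr
    have h3 : g * t * ∑ j ∈ Finset.range n, 1 / (j : ℝ) ≤ g * t * (1 + Real.log n) := by
      gcongr
      exact sum_range_one_div_le n
    linarith

end LowerBound

section Asymptotics

lemma eventually_mul_pow_le_two_rpow :
    ∀ᶠ y : ℝ in atTop, (2 : ℝ) ^ 21 * y ^ 6 ≤ 2 ^ (y / 4) := by
  have h := (isLittleO_pow_exp_pos_mul_atTop 6
    (show 0 < Real.log 2 / 4 by have := Real.log_pos one_lt_two; positivity)).bound
    (show (0 : ℝ) < (2 ^ 21)⁻¹ by positivity)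
  filter_upwards [h, eventually_ge_atTop 0] with y hy hy0
  rw [Real.norm_of_nonneg (by positivity), Real.norm_of_nonneg (by positivity),
    inv_mul_eq_div, le_div_iff₀ (by positivity)] at hy
  rw [Real.rpow_def_of_pos (by norm_num), mul_comm]
  refine hy.trans_eq ?_
  congr 1
  ring

/-- The random graph satisfies `τ(G) ≥ n - C (log₂ n)³` asymptotically almost surely. -/
theorem eventually_density_bipartitionNumber_lt_le : ∀ᶠ n : ℕ in atTop,
    density (fun x : Finset (Sym2 (Fin n)) =>
      ¬ (n : ℝ) - 2 ^ 42 * Real.logb 2 n ^ 3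
        ≤ bipartitionNumber (SimpleGraph.fromEdgeSet (x : Set (Sym2 (Fin n)))))
      ≤ 3 * (n : ℝ)⁻¹ := by
  have hroot : Tendsto (fun n : ℕ => Real.logb 2 n ^ (1 / 6 : ℝ)) atTop atTop :=
    (tendsto_rpow_atTop (by norm_num)).comp tendsto_logb_two_natCast
  filter_upwards [eventually_ge_atTop 2, hroot.eventually eventually_mul_pow_le_two_rpow] with n hn hy
  have hn' : (2 : ℝ) ≤ n := by exact_mod_cast hn
  set l := Real.logb 2 n with hl
  have hl1 : 1 ≤ l := by
    rw [hl, Real.le_logb_iff_rpow_le one_lt_two (by linarith), Real.rpow_one]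
    exact hn'
  set y := l ^ (1 / 6 : ℝ) with hydef
  have hy1 : 1 ≤ y := Real.one_le_rpow hl1 (by norm_num)
  have hyl : y ^ 6 = l := by
    rw [hydef, ← Real.rpow_natCast, ← Real.rpow_mul (by linarith)]
    norm_num
  set L := ⌈3 * l⌉₊ with hL
  set t := ⌈y⌉₊ with ht
  have hL1 : 3 * l ≤ L := Nat.le_ceil _
  have hL2 : (L : ℝ) ≤ 4 * l := by
    linarith [Nat.ceil_lt_add_one (show 0 ≤ 3 * l by linarith)]
  have ht1 : y ≤ t := Nat.le_ceil _
  have ht2 : (t : ℝ) ≤ 2 * y := by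
    linarith [Nat.ceil_lt_add_one (show 0 ≤ y by linarith)]
  have ht0 : 1 ≤ t := by
    have : (1 : ℝ) ≤ t := hy1.trans ht1
    exact_mod_cast this
  have hL0 : 1 ≤ L := by
    have : (1 : ℝ) ≤ L := by linarith
    exact_mod_cast this
  have hlogn : Real.log n ≤ l := by
    rw [hl, Real.logb, le_div_iff₀ (Real.log_pos one_lt_two)]
    have h2 : Real.log 2 ≤ 1 := by linarith [Real.log_two_lt_d9]
    nlinarith [Real.log_nonneg (show (1 : ℝ) ≤ n by linarith)]
  have hlog0 : 0 < Real.log (n + 1) := Real.log_pos (by linarith)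
  have hlogn1 : Real.log (n + 1) ≤ 2 * l := by
    have h1 : Real.log (n + 1) ≤ Real.log ((n : ℝ) ^ 2) :=
      Real.log_le_log (by linarith) (by nlinarith)
    rw [Real.log_pow] at h1
    push_cast at h1
    linarith
  set g := 2 ^ 32 * (t : ℝ) ^ 4 * Real.log (n + 1) with hg
  have htpos : (0 : ℝ) < t := by linarith
  have hg0 : 0 < g := by positivity
  have hg1 : g ≤ 2 ^ 37 * y ^ 10 := by
    calc g ≤ 2 ^ 32 * (2 * y) ^ 4 * (2 * l) := by
          rw [hg]; gcongr
      _ = _ := by rw [← hyl]; ring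
  have hgL : g ≤ 2 ^ 35 * L ^ 3 := by
    calc g ≤ 2 ^ 37 * y ^ 10 := hg1
      _ ≤ 2 ^ 37 * y ^ 18 := by
          gcongr
          norm_num
      _ ≤ 2 ^ 35 * (3 * y ^ 6) ^ 3 := by
          have : 0 ≤ y ^ 18 := by positivity
          nlinarith
      _ ≤ 2 ^ 35 * L ^ 3 := by
          rw [hyl]; gcongr
  have htL : (2 : ℝ) ^ 19 * L ≤ 2 ^ ((t : ℝ) / 4) := by
    calc (2 : ℝ) ^ 19 * L ≤ 2 ^ 19 * (4 * l) := by gcongr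
      _ = 2 ^ 21 * y ^ 6 := by rw [hyl]; ring
      _ ≤ 2 ^ (y / 4) := hy
      _ ≤ _ := Real.rpow_le_rpow_of_exponent_le (by norm_num) (by linarith)
  have hmain := density_not_isPseudorandom_le (V := Fin n) (L := L) (t := t) (g := g)
    (by simpa using hn) (by simpa using hL1) ht0 htL (by simp [hg]) hgL
  rw [Fintype.card_fin] at hmain
  refine (density_mono fun x hx hps => hx ?_).trans hmain
  refine le_trans ?_ (hps.le_bipartitionNumber hg0 hL0)
  refine sub_le_sub_left ?_ _
  have h1 : (2 : ℝ) ^ 35 * L ^ 3 ≤ 2 ^ 41 * y ^ 18 := by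
    calc (2 : ℝ) ^ 35 * L ^ 3 ≤ 2 ^ 35 * (4 * l) ^ 3 := by gcongr
      _ = _ := by rw [← hyl]; ring
  have h2 : g * t * (2 + Real.log n) ≤ 2 ^ 41 * y ^ 18 := by
    calc g * t * (2 + Real.log n) ≤ 2 ^ 37 * y ^ 10 * (2 * y) * (3 * l) := by
          gcongr
          linarith
      _ = 6 * 2 ^ 37 * y ^ 17 := by rw [← hyl]; ring
      _ ≤ 6 * 2 ^ 37 * y ^ 18 := by
          gcongr
          norm_num
      _ ≤ _ := by
          have : 0 ≤ y ^ 18 := by positivity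
          nlinarith
  calc _ ≤ 2 ^ 41 * y ^ 18 + 2 ^ 41 * y ^ 18 := add_le_add h1 h2
    _ = _ := by rw [← hyl]; ring

lemma density_le_and_add_not {E : Type*} [Fintype E] (p p' : Finset E → Prop) :
    density p ≤ density (fun x => p' x ∧ p x) + density fun x => ¬ p' x := by
  refine (density_mono fun x hx => ?_).trans (density_or_le _ _)
  by_cases h : p' x
  · exact Or.inl ⟨h, hx⟩
  · exact Or.inr h

end Asymptotics

theorem theorem1 :
    ∃ δ : ℕ → ℝ, Tendsto δ atTop (𝓝 0) ∧
      ∀ c ε : ℝ, 0 < c → 0 < ε →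
        Tendsto
          (fun n : ℕ => randomGraphHalf n
            {G : SimpleGraph (Fin n) |
              (n : ℝ) - c * (Real.logb 2 n) ^ (3 + ε) ≤ (bipartitionNumber G : ℝ) ∧
              (bipartitionNumber G : ℝ) ≤ (n : ℝ) - (2 + δ n) * Real.logb 2 n})
          atTop (𝓝 1) := by
  obtain ⟨δ, hδ, hupper⟩ := tendsto_bipartitionNumber_le
  refine ⟨δ, hδ, fun c ε hc hε => ?_⟩
  suffices h : Tendsto (fun n : ℕ => (randomGraphHalf n).real
      {G : SimpleGraph (Fin n) |
        (n : ℝ) - c * (Real.logb 2 n) ^ (3 + ε) ≤ (bipartitionNumber G : ℝ) ∧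
        (bipartitionNumber G : ℝ) ≤ (n : ℝ) - (2 + δ n) * Real.logb 2 n}) atTop (𝓝 1) by
    simpa [ofReal_measureReal] using ENNReal.tendsto_ofReal h
  have hlow : Tendsto (fun n : ℕ => (randomGraphHalf n).real
      {G | (bipartitionNumber G : ℝ) ≤ n - (2 + δ n) * Real.logb 2 n} - 3 * (n : ℝ)⁻¹)
      atTop (𝓝 1) := by
    simpa using hupper.sub
      ((tendsto_inv_atTop_zero.comp tendsto_natCast_atTop_atTop).const_mul (3 : ℝ))
  refine tendsto_of_tendsto_of_tendsto_of_le_of_le' hlow tendsto_const_nhds ?_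
    (Eventually.of_forall fun n => measureReal_le_one)
  have hpow : ∀ᶠ n : ℕ in atTop, 2 ^ 42 / c ≤ Real.logb 2 n ^ ε :=
    ((tendsto_rpow_atTop hε).comp tendsto_logb_two_natCast).eventually_ge_atTop _
  filter_upwards [eventually_density_bipartitionNumber_lt_le, hpow,
    tendsto_logb_two_natCast.eventually_gt_atTop 0] with n hn hpow hl
  rw [randomGraphHalf_real, randomGraphHalf_real, sub_le_iff_le_add]
  refine (density_le_and_add_not _ fun x : Finset (Sym2 (Fin n)) =>
    (n : ℝ) - c * (Real.logb 2 n) ^ (3 + ε)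
      ≤ bipartitionNumber (SimpleGraph.fromEdgeSet (x : Set (Sym2 (Fin n))))).trans
    (add_le_add_right ((density_mono fun x hx hx' => hx ?_).trans hn) _)
  refine le_trans (sub_le_sub_left ?_ _) hx'
  rw [div_le_iff₀ hc] at hpow
  rw [Real.rpow_add hl, show (3 : ℝ) = (3 : ℕ) by norm_num, Real.rpow_natCast]
  have : (0 : ℝ) ≤ Real.logb 2 n ^ 3 := by positivity
  nlinarith
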